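/- Let $\mathcal X,\mathcal Y$ be finite non-empty alphabets, let $W(y|x)$ be a channel from $\mathcal X$ to $\mathcal Y$, and let $q:\mathcal X\times\mathcal Y\to[0,\infty)$ be a decoding metric with $q(x,y)>0$ whenever $W(y|x)>0$. Put $W^n(y^n|x^n)=\prod_{i=1}^n W(y_i|x_i)$ and $q^n(x^n,y^n)=\prod_{i=1}^n q(x_i,y_i)$. For a code with codewords $x^n(1),\dots,x^n(M)\in\mathcal X^n$ and equiprobable messages, the stochastic likelihood decoder, on receiving $y^n$, outputs message $m$ with probability $q^n(x^n(m),y^n)/\sum_{\bar m=1}^{M}q^n(x^n(\bar m),y^n)$. The mismatch capacity $\widetilde C_q(W)$ is the supremum of all $R\in\mathbb R$ for which there are codes $\mathcal C_n\subseteq\mathcal X^n$, $n\ge1$, with $M_n=|\mathcal C_n|\ge 1$ (distinct) codewords, $\liminf_{n\to\infty}\frac1n\log M_n\ge R$, and average error probability under this decoder tending to $0$. For $k\ge1$ and a distribution $P_{X^k}$ on $\mathcal X^k$ let $(X^k,Y^k)\sim P_{X^k}W^k$, let $\bar X^k\sim P_{X^k}$ be independent of $(X^k,Y^k)$, and put $$I^{(k)}_{\rm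 GMI}(P_{X^k})=\sup_{s\in(0,1]}\mathbb E\left[\log\frac{q^k(X^k,Y^k)^s}{\mathbb E[q^k(\bar X^k,Y^k)^s\mid Y^k]}\right],\qquad I^{(k)}_{\rm LM}(P_{X^k})=\sup_{s\in(0,1],\ a:\mathcal X^k\to\mathbb R}\mathbb E\left[\log\frac{q^k(X^k,Y^k)^s e^{a(X^k)}}{\mathbb E[q^k(\bar X^k,Y^k)^s e^{a(\bar X^k)}\mid Y^k]}\right].$$ Then the following three limits exist and $$\widetilde C_q(W)=\lim_{k\to\infty}\sup_{P_{X^k}}\tfrac1k I^{(k)}_{\rm GMI}(P_{X^k})=\lim_{k\to\infty}\sup_{P_{X^k}}\tfrac1k I^{(k)}_{\rm LM}(P_{X^k})=\lim_{k\to\infty}\sup_{P_{X^k}}\frac1k\,\mathbb E\left[\log\frac{q^k(X^k,Y^k)}{\mathbb E[q^k(\bar X^k,Y^k)\mid Y^k]}\right].$$ Moreover, the capacity is achieved by product-space random coding. For every $R<\widetilde C_q(W)$ and all sufficiently large $k$: (i) there is a distribution $P_{X^k}$ on $\mathcal X^k$ with $R<\frac1k I^{(k)}_{\rm GMI}(P_{X^k})$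 such that the random code of block length $kl$ with $\lceil e^{klR}\rceil$ independent codewords, each consisting of $l$ i.i.d. blocks with law $P_{X^k}$, has average error probability (over the code, the channel and the decoder) tending to $0$ as $l\to\infty$; (ii) there are a distribution $P_{X^k}$ on $\mathcal X^k$ with $R<\frac1k I^{(k)}_{\rm LM}(P_{X^k})$ and types (empirical distributions of sequences of $l$ blocks) $P_l$ over the alphabet $\mathcal X^k$ with $P_l\to P_{X^k}$ such that the random code of block length $kl$ with $\lceil e^{klR}\rceil$ independent codewords, each uniform on the set of sequences of $l$ blocks of type $P_l$, has average error probability tending to $0$ as $l\to\infty$. -/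

import Mathlib

open Filter Topology Finset

namespace StochDec

/-- The `n`-fold memoryless (product) extension `wⁿ(xⁿ, yⁿ) = ∏ᵢ w(xᵢ, yᵢ)` of a channel law
or of a decoding metric. -/
noncomputable def prodExt {X Y : Type*} (n : ℕ) (w : X → Y → ℝ)
    (x : Fin n → X) (y : Fin n → Y) : ℝ :=
  ∏ i, w (x i) (y i)

section OneShot

variable {U V : Type*} [Fintype V]

/-- Probability that the stochastic likelihood decoder with metric `q` and codebook `c`
outputs the message `m` when `y` is received. -/
noncomputable def decodeProb {M : ℕ} (q : U → V → ℝ) (c : Fin M → U) (y : V) (m : Fin M) : ℝ :=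
  q (c m) y / ∑ m', q (c m') y

/-- Average error probability of the code `c`, with equiprobable messages, over the channel `W`
under stochastic likelihood decoding with metric `q`. -/
noncomputable def errorProb {M : ℕ} (W q : U → V → ℝ) (c : Fin M → U) : ℝ :=
  1 - (1 / (M : ℝ)) * ∑ m, ∑ y, W (c m) y * decodeProb q c y m

variable [Fintype U]

/-- Average of the error probability over the random code whose `M` codewords are drawn
independently with law `Q`. -/
noncomputable def ensembleError (W q : U → V → ℝ) (Q : U → ℝ) (M : ℕ) : ℝ :=
  ∑ c : Fin M → U, (∏ m, Q (c m)) * errorProb W q c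

/-- `E[log (q(X,Y) / E[q(X̄,Y) | Y])]`, where `(X,Y) ∼ P × W` and `X̄ ∼ P` is independent
of `(X, Y)`. -/
noncomputable def meanDensity (W q : U → V → ℝ) (P : U → ℝ) : ℝ :=
  ∑ x, ∑ y, P x * W x y * Real.log (q x y / ∑ x', P x' * q x' y)

/-- `E[log (q(X,Y)ˢ / E[q(X̄,Y)ˢ | Y])]`. -/
noncomputable def gmiDensity (W q : U → V → ℝ) (P : U → ℝ) (s : ℝ) : ℝ :=
  ∑ x, ∑ y, P x * W x y * Real.log (q x y ^ s / ∑ x', P x' * q x' y ^ s)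

/-- `E[log (q(X,Y)ˢ e^{a(X)} / E[q(X̄,Y)ˢ e^{a(X̄)} | Y])]`. -/
noncomputable def lmDensity (W q : U → V → ℝ) (P : U → ℝ) (s : ℝ) (a : U → ℝ) : ℝ :=
  ∑ x, ∑ y, P x * W x y *
    Real.log (q x y ^ s * Real.exp (a x) / ∑ x', P x' * (q x' y ^ s * Real.exp (a x')))

end OneShot

section RandomCoding

variable {U : Type*} [Fintype U]

/-- The law of `l` i.i.d. letters with distribution `P`. -/
noncomputable def iidLaw (l : ℕ) (P : U → ℝ) (x : Fin l → U) : ℝ := ∏ j, P (x j)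

open Classical in
/-- The type class of all sequences of length `l` in which each letter `u` occurs exactly
`N u` times. -/
noncomputable def typeClass (l : ℕ) (N : U → ℕ) : Finset (Fin l → U) :=
  univ.filter fun x => ∀ u, (univ.filter fun j => x j = u).card = N u

open Classical in
/-- The uniform law on the type class of composition `N`. -/
noncomputable def constCompLaw (l : ℕ) (N : U → ℕ) (x : Fin l → U) : ℝ :=
  if x ∈ typeClass l N then 1 / ((typeClass l N).card : ℝ) else 0

end RandomCoding

section Memoryless

variable {X Y : Type*} [Fintype X] [Fintype Y]

/-- `R` is an achievable rate: there are codes of every length `n` with `M n` distinct codewords,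
asymptotic rate at least `R`, and vanishing error probability. -/
def IsAchievable (W q : X → Y → ℝ) (R : ℝ) : Prop :=
  ∃ (M : ℕ → ℕ) (c : ∀ n, Fin (M n) → Fin n → X),
    (∀ n, 0 < M n) ∧ (∀ n, Function.Injective (c n)) ∧
    (R : EReal) ≤ liminf (fun n => ((Real.log (M n) / n : ℝ) : EReal)) atTop ∧
    Tendsto (fun n => errorProb (prodExt n W) (prodExt n q) (c n)) atTop (𝓝 0)

/-- The mismatch capacity under stochastic likelihood decoding. -/
noncomputable def mismatchCapacity (W q : X → Y → ℝ) : EReal :=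
  ⨆ (R : ℝ) (_ : IsAchievable W q R), (R : EReal)

/-- The normalized `k`-letter GMI of the input distribution `P` on `Xᵏ`. -/
noncomputable def gmiRate (W q : X → Y → ℝ) (k : ℕ) (P : (Fin k → X) → ℝ) : EReal :=
  ⨆ s ∈ Set.Ioc (0 : ℝ) 1,
    ((1 / (k : ℝ) * gmiDensity (prodExt k W) (prodExt k q) P s : ℝ) : EReal)

/-- The normalized `k`-letter LM rate of the input distribution `P` on `Xᵏ`. -/
noncomputable def lmRate (W q : X → Y → ℝ) (k : ℕ) (P : (Fin k → X) → ℝ) : EReal :=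
  ⨆ s ∈ Set.Ioc (0 : ℝ) 1, ⨆ a : (Fin k → X) → ℝ,
    ((1 / (k : ℝ) * lmDensity (prodExt k W) (prodExt k q) P s a : ℝ) : EReal)

/-- The optimized `k`-letter GMI rate. -/
noncomputable def gmiCapacity (W q : X → Y → ℝ) (k : ℕ) : EReal :=
  ⨆ P ∈ stdSimplex ℝ (Fin k → X), gmiRate W q k P

/-- The optimized `k`-letter LM rate. -/
noncomputable def lmCapacity (W q : X → Y → ℝ) (k : ℕ) : EReal :=
  ⨆ P ∈ stdSimplex ℝ (Fin k → X), lmRate W q k P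

/-- `sup_P (1/k) E[log (qᵏ(Xᵏ,Yᵏ) / E[qᵏ(X̄ᵏ,Yᵏ) | Yᵏ])]`. -/
noncomputable def meanDensityCapacity (W q : X → Y → ℝ) (k : ℕ) : EReal :=
  ⨆ P ∈ stdSimplex ℝ (Fin k → X),
    ((1 / (k : ℝ) * meanDensity (prodExt k W) (prodExt k q) P : ℝ) : EReal)

/-- Average error probability of random coding over the product alphabet `Xᵏ`: there are
`⌈exp (k l R)⌉` independent codewords, each made of `l` blocks of `k` channel inputs
(so the block length is `k l`) and drawn with law `Q`. -/
noncomputable def blockEnsembleError (W q : X → Y → ℝ) (k l : ℕ) (R : ℝ)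
    (Q : (Fin l → Fin k → X) → ℝ) : ℝ :=
  ensembleError (prodExt l (prodExt k W)) (prodExt l (prodExt k q)) Q
    ⌈Real.exp ((k : ℝ) * l * R)⌉₊

/-- `R` is achieved by product-space i.i.d. random coding with block distribution `P` on `Xᵏ`. -/
def IIDAchieves (W q : X → Y → ℝ) (k : ℕ) (P : (Fin k → X) → ℝ) (R : ℝ) : Prop :=
  Tendsto (fun l => blockEnsembleError W q k l R (iidLaw l P)) atTop (𝓝 0)

/-- `R` is achieved by product-space constant-composition random coding, with types over the
alphabet `Xᵏ` that converge to `P`. -/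
def ConstCompAchieves (W q : X → Y → ℝ) (k : ℕ) (P : (Fin k → X) → ℝ) (R : ℝ) : Prop :=
  ∃ N : ℕ → (Fin k → X) → ℕ,
    (∀ l, ∑ u, N l u = l) ∧
    (∀ u, Tendsto (fun l => (N l u : ℝ) / l) atTop (𝓝 (P u))) ∧
    Tendsto (fun l => blockEnsembleError W q k l R (constCompLaw l (N l))) atTop (𝓝 0)

end Memoryless

end StochDec

/-!
The normalized density `(1/k) E[log (qᵏ(X,Y) / E[qᵏ(X̄,Y) | Y])]` is at most the `k`-letter GMI rate
(take `s = 1`), which is at most the `k`-letter LM rate (take `a = 0`). All three limits therefore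
follow from a converse for the smallest quantity and an achievability result for the largest one.

*Converse* (`eventually_lt_meanDensity`). If `X` is uniform on the codewords of a code with `M`
messages, then `q(X,Y) / E[q(X̄,Y) | Y]` is `M` times the probability that the stochastic decoder
decodes correctly, so the mean density is `log M + E[log (decoding probability)]`. The decoding
probability is never below `exp (-n L)` on possible outputs, and it is below `1 / 2` only with
probability at most twice the error probability. Hence the last expectation is `o(n)` when the
error probability vanishes.

*Achievability* (`constCompAchieves_of_lt`, `iidAchieves_of_lt`). A competing codeword whose metric
is `t` times that of the transmitted one is chosen with probability at most `t / (1 + t) ≤ tˢ` for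
`s ∈ [0, 1]`. Averaging over the random code bounds the error probability by
`E[(M E[q(X̄,Y)ˢ | Y] / q(X,Y)ˢ) ^ ρ]` for every `ρ ∈ [0, 1]` (`ensembleError_le_sum_rpow`). For
i.i.d. blocks this bound factorizes over the blocks, and its expansion at `ρ = 0` shows exponential
decay below the GMI. For constant-composition codes the cost `∑ a(Xⱼ)` is constant, so it can be
inserted in the numerator and the denominator for free, and the uniform law on a type class is
dominated by an i.i.d. law up to a subexponential factor (`exists_constCompLaw_le`), which gives
exponential decay below the LM rate.

Random codes may have repeated codewords and only exist at lengths divisible by `k`. A message with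
a repeated codeword has error probability at least `1 / 2`, so expurgating a code with a small
average error probability removes at most half of its messages (`exists_injective_code`). The
remaining lengths are reached by padding with a constant letter (`exists_padded_code`).
-/

namespace StochDec

/-! ### Product extensions -/

section ProdExt

variable {X Y : Type*}

lemma prodExt_nonneg {w : X → Y → ℝ} (hw : ∀ x y, 0 ≤ w x y) (n : ℕ) (x : Fin n → X)
    (y : Fin n → Y) : 0 ≤ prodExt n w x y :=
  prod_nonneg fun _ _ => hw _ _

lemma sum_prodExt [Fintype Y] {w : X → Y → ℝ} (hw : ∀ x, ∑ y, w x y = 1) (n : ℕ)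
    (x : Fin n → X) : ∑ y, prodExt n w x y = 1 := by
  simp only [prodExt]
  rw [← Fintype.prod_sum fun i y => w (x i) y]
  simp [hw]

lemma pos_of_prodExt_pos {w : X → Y → ℝ} (hw : ∀ x y, 0 ≤ w x y) {n : ℕ} {x : Fin n → X}
    {y : Fin n → Y} (h : 0 < prodExt n w x y) (i : Fin n) : 0 < w (x i) (y i) :=
  (hw _ _).lt_of_ne' (prod_ne_zero_iff.1 h.ne' i (mem_univ i))

lemma prodExt_pos_of_pos {w q : X → Y → ℝ} (hw : ∀ x y, 0 ≤ w x y)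
    (hq : ∀ x y, 0 < w x y → 0 < q x y) (n : ℕ) (x : Fin n → X) (y : Fin n → Y)
    (h : 0 < prodExt n w x y) : 0 < prodExt n q x y :=
  prod_pos fun i _ => hq _ _ (pos_of_prodExt_pos hw h i)

lemma sum_iidLaw [Fintype X] {P : X → ℝ} (hP : ∑ u, P u = 1) (l : ℕ) :
    ∑ x, iidLaw l P x = 1 := by
  simp only [iidLaw]
  rw [← Fintype.prod_sum fun _ u => P u]
  simp [hP]

end ProdExt

/-! ### The error probability of a code -/

section ErrorProb

variable {U V : Type*}

lemma decodeProb_le_one {q : U → V → ℝ} (hq : ∀ u v, 0 ≤ q u v) {M : ℕ} (c : Fin M → U) (y : V)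
    (m : Fin M) : decodeProb q c y m ≤ 1 :=
  div_le_one_of_le₀ (single_le_sum (f := fun m => q (c m) y) (fun _ _ => hq _ _) (mem_univ m))
    (sum_nonneg fun _ _ => hq _ _)

variable [Fintype V]

/-- The error probability of the message `m` of the code `c` under stochastic likelihood
decoding. -/
noncomputable def messageError {M : ℕ} (W q : U → V → ℝ) (c : Fin M → U) (m : Fin M) : ℝ :=
  ∑ y, W (c m) y * (1 - decodeProb q c y m)

lemma messageError_nonneg {W q : U → V → ℝ} (hW : ∀ u v, 0 ≤ W u v) (hq : ∀ u v, 0 ≤ q u v)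
    {M : ℕ} (c : Fin M → U) (m : Fin M) : 0 ≤ messageError W q c m :=
  sum_nonneg fun _ _ => mul_nonneg (hW _ _) (sub_nonneg.2 (decodeProb_le_one hq _ _ _))

lemma errorProb_eq_average {W q : U → V → ℝ} (hW : ∀ u, ∑ v, W u v = 1) {M : ℕ} (hM : 0 < M)
    (c : Fin M → U) : errorProb W q c = 1 / (M : ℝ) * ∑ m, messageError W q c m := by
  have hM' : (M : ℝ) ≠ 0 := by positivity
  simp only [errorProb, messageError, mul_sub, mul_one, sum_sub_distrib, hW]
  simp [hM']

lemma errorProb_nonneg {W q : U → V → ℝ} (hW : ∀ u v, 0 ≤ W u v) (hW1 : ∀ u, ∑ v, W u v = 1)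
    (hq : ∀ u v, 0 ≤ q u v) {M : ℕ} (hM : 0 < M) (c : Fin M → U) : 0 ≤ errorProb W q c := by
  rw [errorProb_eq_average hW1 hM]
  exact mul_nonneg (by positivity) (sum_nonneg fun m _ => messageError_nonneg hW hq c m)

end ErrorProb

/-! ### A one-shot random coding bound -/

section OneShotBound

variable {U V : Type*} [Fintype U]

lemma sum_prod_mul_apply {Q : U → ℝ} (hQ : ∑ u, Q u = 1) {n : ℕ} (f : U → ℝ) (i : Fin n) :
    ∑ c : Fin n → U, (∏ j, Q (c j)) * f (c i) = ∑ u, Q u * f u := by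
  have h : ∀ c : Fin n → U, (∏ j, Q (c j)) * f (c i) =
      ∏ j, (Q (c j) * if j = i then f (c j) else 1) := by
    intro c
    rw [prod_mul_distrib]
    simp
  simp only [h]
  rw [← Fintype.prod_sum fun j u => Q u * if j = i then f u else 1]
  rw [prod_eq_single i]
  · simp
  · intro j _ hj
    simp [hj, hQ]
  · simp

lemma sum_prod_pi {Q : U → ℝ} (hQ : ∑ u, Q u = 1) (n : ℕ) :
    ∑ c : Fin n → U, ∏ j, Q (c j) = 1 := sum_iidLaw hQ n

/-- The decoder confuses a transmitted codeword of metric `a` with codewords of metrics `b i`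
with probability at most `∑ (b i / a) ^ s`: each ratio `t` contributes `t / (1 + t) ≤ t ^ s`. -/
lemma one_sub_div_le_sum_rpow {n : ℕ} {a s : ℝ} (ha : 0 < a) (hs : 0 ≤ s) (hs1 : s ≤ 1)
    {b : Fin n → ℝ} (hb : ∀ i, 0 ≤ b i) :
    1 - a / (a + ∑ i, b i) ≤ ∑ i, (b i / a) ^ s := by
  have hS : 0 ≤ ∑ i, b i := sum_nonneg fun i _ => hb i
  have h1 : 1 - a / (a + ∑ i, b i) = ∑ i, b i / (a + ∑ i, b i) := by
    rw [← sum_div]; field_simp; ring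
  rw [h1]
  refine sum_le_sum fun i hi => ?_
  have hbi : b i ≤ ∑ i, b i := single_le_sum (f := b) (fun i _ => hb i) hi
  rcases le_total (b i / a) 1 with h | h
  · calc b i / (a + ∑ i, b i) ≤ b i / a :=
          div_le_div_of_nonneg_left (hb i) ha (by linarith)
      _ = (b i / a) ^ (1 : ℝ) := (Real.rpow_one _).symm
      _ ≤ (b i / a) ^ s := Real.rpow_le_rpow_of_exponent_ge_of_imp
          (div_nonneg (hb i) ha.le) h hs1 (fun h0 h1 => by simp_all)
  · calc b i / (a + ∑ i, b i) ≤ 1 := div_le_one_of_le₀ (by linarith) (by linarith)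
      _ ≤ (b i / a) ^ s := Real.one_le_rpow h hs

/-- Averaged over `n` independent wrong codewords, the probability of confusing a transmitted
codeword is at most both `1` and the expectation of the bound `one_sub_div_le_sum_rpow`, hence at
most any power `ρ ∈ [0, 1]` of that expectation. -/
lemma average_one_sub_div_le {q : U → V → ℝ} (hq : ∀ u v, 0 ≤ q u v) {Q : U → ℝ}
    (hQ : ∀ u, 0 ≤ Q u) (hQ1 : ∑ u, Q u = 1) {s ρ : ℝ} (hs : 0 ≤ s) (hs1 : s ≤ 1)
    (hρ : 0 ≤ ρ) (hρ1 : ρ ≤ 1) (n : ℕ) (u : U) (v : V) (hu : 0 < q u v) :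
    ∑ c : Fin n → U, (∏ j, Q (c j)) * (1 - q u v / (q u v + ∑ i, q (c i) v)) ≤
      ((n : ℝ) * ((∑ u', Q u' * q u' v ^ s) / q u v ^ s)) ^ ρ := by
  have hprod : ∀ c : Fin n → U, 0 ≤ ∏ j, Q (c j) := fun c => prod_nonneg fun _ _ => hQ _
  set E := ∑ c : Fin n → U, (∏ j, Q (c j)) * (1 - q u v / (q u v + ∑ i, q (c i) v)) with hE
  set Z := (n : ℝ) * ((∑ u', Q u' * q u' v ^ s) / q u v ^ s) with hZ
  have hZ0 : 0 ≤ Z := by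
    have : 0 ≤ ∑ u', Q u' * q u' v ^ s :=
      sum_nonneg fun _ _ => mul_nonneg (hQ _) (Real.rpow_nonneg (hq _ _) _)
    positivity
  have hE1 : E ≤ 1 := by
    calc E ≤ ∑ c : Fin n → U, (∏ j, Q (c j)) * 1 := by
          refine sum_le_sum fun c _ => mul_le_mul_of_nonneg_left ?_ (hprod c)
          have : 0 ≤ ∑ i, q (c i) v := sum_nonneg fun _ _ => hq _ _
          have : 0 ≤ q u v / (q u v + ∑ i, q (c i) v) := by positivity
          linarith
      _ = 1 := by simp [sum_prod_pi hQ1]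
  have hEZ : E ≤ Z := by
    calc E ≤ ∑ c : Fin n → U, (∏ j, Q (c j)) * ∑ i, (q (c i) v / q u v) ^ s :=
          sum_le_sum fun c _ => mul_le_mul_of_nonneg_left
            (one_sub_div_le_sum_rpow hu hs hs1 fun i => hq _ _) (hprod c)
      _ = ∑ i : Fin n, ∑ c : Fin n → U, (∏ j, Q (c j)) * (q (c i) v / q u v) ^ s := by
          rw [sum_comm]; simp only [mul_sum]
      _ = Z := by
          simp only [sum_prod_mul_apply hQ1 fun u' => (q u' v / q u v) ^ s]
          rw [sum_const, card_univ, Fintype.card_fin, nsmul_eq_mul, hZ, sum_div]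
          congr 1
          refine sum_congr rfl fun u' _ => ?_
          rw [Real.div_rpow (hq _ _) hu.le, mul_div_assoc]
  rcases le_total Z 1 with h | h
  · refine hEZ.trans ?_
    rcases hZ0.eq_or_lt with h0 | h0
    · rw [← h0]; exact Real.rpow_nonneg le_rfl _
    · simpa using Real.rpow_le_rpow_of_exponent_ge h0 h hρ1
  · exact hE1.trans (Real.one_le_rpow h hρ)

variable [Fintype V]

/-- One-shot random coding bound of Gallager type. -/
theorem ensembleError_le_sum_rpow {W q : U → V → ℝ} (hW : ∀ u v, 0 ≤ W u v)
    (hW1 : ∀ u, ∑ v, W u v = 1) (hq : ∀ u v, 0 ≤ q u v) (hWq : ∀ u v, 0 < W u v → 0 < q u v)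
    {Q : U → ℝ} (hQ : ∀ u, 0 ≤ Q u) (hQ1 : ∑ u, Q u = 1) {s ρ : ℝ} (hs : 0 ≤ s) (hs1 : s ≤ 1)
    (hρ : 0 ≤ ρ) (hρ1 : ρ ≤ 1) {M : ℕ} (hM : 0 < M) :
    ensembleError W q Q M ≤
      ∑ u, ∑ v, Q u * W u v *
        (((M : ℝ) - 1) * ((∑ u', Q u' * q u' v ^ s) / q u v ^ s)) ^ ρ := by
  obtain ⟨n, rfl⟩ : ∃ n, M = n + 1 := ⟨M - 1, by omega⟩
  set B := ∑ u, ∑ v, Q u * W u v *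
        ((((n + 1 : ℕ) : ℝ) - 1) * ((∑ u', Q u' * q u' v ^ s) / q u v ^ s)) ^ ρ with hB
  have key : ∀ m : Fin (n + 1),
      ∑ c : Fin (n + 1) → U, (∏ j, Q (c j)) * messageError W q c m ≤ B := by
    intro m
    rw [← (Fin.insertNthEquiv (fun _ => U) m).sum_comp, Fintype.sum_prod_type, hB]
    refine sum_le_sum fun u _ => ?_
    simp only [Fin.insertNthEquiv_apply, messageError, decodeProb, Fin.prod_univ_succAbove _ m,
      Fin.sum_univ_succAbove _ m, Fin.insertNth_apply_same, Fin.insertNth_apply_succAbove,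
      mul_sum]
    rw [sum_comm]
    refine sum_le_sum fun v _ => ?_
    rcases (hW u v).eq_or_lt with h | h
    · simp [← h]
    · have := average_one_sub_div_le hq hQ hQ1 hs hs1 hρ hρ1 n u v (hWq u v h)
      push_cast
      rw [add_sub_cancel_right]
      refine le_trans (le_of_eq ?_)
        (mul_le_mul_of_nonneg_left this (mul_nonneg (hQ u) (hW u v)))
      rw [mul_sum]
      exact sum_congr rfl fun c _ => by ring
  calc ensembleError W q Q (n + 1)
      = 1 / ((n + 1 : ℕ) : ℝ) *
          ∑ m, ∑ c : Fin (n + 1) → U, (∏ j, Q (c j)) * messageError W q c m := by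
        rw [sum_comm, mul_sum]
        refine sum_congr rfl fun c _ => ?_
        rw [errorProb_eq_average hW1 hM, mul_left_comm, mul_sum]
    _ ≤ 1 / ((n + 1 : ℕ) : ℝ) * ∑ m : Fin (n + 1), B :=
        mul_le_mul_of_nonneg_left (sum_le_sum fun m _ => key m) (by positivity)
    _ = B := by
        rw [sum_const, card_univ, Fintype.card_fin, nsmul_eq_mul, ← mul_assoc,
          one_div_mul_cancel (by positivity), one_mul]

/-- Some code is at least as good as the average of the random code. -/
lemma exists_errorProb_le_ensembleError (W q : U → V → ℝ) {Q : U → ℝ} (hQ : ∀ u, 0 ≤ Q u)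
    (hQ1 : ∑ u, Q u = 1) (M : ℕ) :
    ∃ c : Fin M → U, errorProb W q c ≤ ensembleError W q Q M := by
  by_contra! h
  have hprod : ∀ c : Fin M → U, 0 ≤ ∏ j, Q (c j) := fun c => prod_nonneg fun _ _ => hQ _
  obtain ⟨c, hc⟩ : ∃ c : Fin M → U, ∏ j, Q (c j) ≠ 0 := by
    by_contra! h0
    simpa [h0] using sum_prod_pi hQ1 M
  have : ∑ c : Fin M → U, (∏ j, Q (c j)) * ensembleError W q Q M < ensembleError W q Q M :=
    sum_lt_sum (fun c _ => mul_le_mul_of_nonneg_left (h c).le (hprod c))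
      ⟨c, mem_univ _, mul_lt_mul_of_pos_left (h c) ((hprod c).lt_of_ne' hc)⟩
  rw [← sum_mul, sum_prod_pi hQ1, one_mul] at this
  exact lt_irrefl _ this

lemma ensembleError_nonneg {W q : U → V → ℝ} (hW : ∀ u v, 0 ≤ W u v)
    (hW1 : ∀ u, ∑ v, W u v = 1) (hq : ∀ u v, 0 ≤ q u v) {Q : U → ℝ} (hQ : ∀ u, 0 ≤ Q u)
    {M : ℕ} (hM : 0 < M) : 0 ≤ ensembleError W q Q M :=
  sum_nonneg fun c _ => mul_nonneg (prod_nonneg fun _ _ => hQ _)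
    (errorProb_nonneg hW hW1 hq hM c)

end OneShotBound

/-! ### Random coding over blocks -/

section Blocks

variable {U V : Type*} [Fintype U] [Fintype V]

/-- The single-letter factor `(E[q(X̄,v)ˢ e^{a(X̄)}] / (q(u,v)ˢ e^{a(u)})) ^ ρ` of the random coding
bound. -/
noncomputable def tiltedRatio (q : U → V → ℝ) (P : U → ℝ) (s : ℝ) (a : U → ℝ) (ρ : ℝ)
    (u : U) (v : V) : ℝ :=
  ((∑ u', P u' * (q u' v ^ s * Real.exp (a u'))) / (q u v ^ s * Real.exp (a u))) ^ ρ

omit [Fintype V] in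
lemma tiltedRatio_nonneg {q : U → V → ℝ} (hq : ∀ u v, 0 ≤ q u v) {P : U → ℝ} (hP : ∀ u, 0 ≤ P u)
    (s : ℝ) (a : U → ℝ) (ρ : ℝ) (u : U) (v : V) : 0 ≤ tiltedRatio q P s a ρ u v :=
  Real.rpow_nonneg (div_nonneg (sum_nonneg fun _ _ => mul_nonneg (hP _)
    (mul_nonneg (Real.rpow_nonneg (hq _ _) _) (Real.exp_pos _).le))
    (mul_nonneg (Real.rpow_nonneg (hq _ _) _) (Real.exp_pos _).le)) _

/-- A block law that is dominated by `K` times an i.i.d. law and on whose support `∑ a(xⱼ)` is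
constant behaves, up to a factor `K²`, like the i.i.d. law with the cost function `a`: the
constant cost cancels between the transmitted and the competing codewords. -/
theorem ensembleError_block_le {W q : U → V → ℝ} (hW : ∀ u v, 0 ≤ W u v)
    (hW1 : ∀ u, ∑ v, W u v = 1) (hq : ∀ u v, 0 ≤ q u v) (hWq : ∀ u v, 0 < W u v → 0 < q u v)
    {P : U → ℝ} (hP : ∀ u, 0 ≤ P u) {s ρ : ℝ} (hs : 0 ≤ s) (hs1 : s ≤ 1) (hρ : 0 ≤ ρ)
    (hρ1 : ρ ≤ 1) (a : U → ℝ) {l : ℕ} {Q : (Fin l → U) → ℝ} (hQ : ∀ x, 0 ≤ Q x)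
    (hQ1 : ∑ x, Q x = 1) {K A : ℝ} (hK : 1 ≤ K) (hQP : ∀ x, Q x ≤ K * iidLaw l P x)
    (hA : ∀ x, Q x ≠ 0 → ∑ j, a (x j) = A) {M : ℕ} (hM : 0 < M) :
    ensembleError (prodExt l W) (prodExt l q) Q M ≤
      K ^ 2 * ((M : ℝ) - 1) ^ ρ *
        (∑ u, ∑ v, P u * W u v * tiltedRatio q P s a ρ u v) ^ l := by
  set G : V → ℝ := fun v => ∑ u', P u' * (q u' v ^ s * Real.exp (a u')) with hG
  have hG0 : ∀ v, 0 ≤ G v := fun v => sum_nonneg fun _ _ => mul_nonneg (hP _)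
    (mul_nonneg (Real.rpow_nonneg (hq _ _) _) (Real.exp_pos _).le)
  have hK0 : 0 ≤ K := zero_le_one.trans hK
  have hM1 : (0 : ℝ) ≤ (M : ℝ) - 1 := by
    have : (1 : ℝ) ≤ M := by exact_mod_cast hM
    linarith
  have hpow : ∀ (x : Fin l → U) (y : Fin l → V), prodExt l q x y ^ s = ∏ j, q (x j) (y j) ^ s :=
    fun x y => (Real.finsetProd_rpow _ _ (fun _ _ => hq _ _) _).symm
  have hS : ∀ y : Fin l → V, ∑ x, Q x * prodExt l q x y ^ s ≤
      K * Real.exp (-A) * ∏ j, G (y j) := by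
    intro y
    rw [hG, Fintype.prod_sum fun j u' => P u' * (q u' (y j) ^ s * Real.exp (a u')), mul_sum]
    refine sum_le_sum fun x _ => ?_
    by_cases h : Q x = 0
    · rw [h, zero_mul]
      exact mul_nonneg (mul_nonneg hK0 (Real.exp_pos _).le) (prod_nonneg fun _ _ =>
        mul_nonneg (hP _) (mul_nonneg (Real.rpow_nonneg (hq _ _) _) (Real.exp_pos _).le))
    · rw [hpow]
      calc Q x * ∏ j, q (x j) (y j) ^ s
          ≤ K * iidLaw l P x * ∏ j, q (x j) (y j) ^ s :=
            mul_le_mul_of_nonneg_right (hQP x)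
              (prod_nonneg fun _ _ => Real.rpow_nonneg (hq _ _) _)
        _ = K * Real.exp (-A) * ∏ j, P (x j) * (q (x j) (y j) ^ s * Real.exp (a (x j))) := by
            rw [prod_mul_distrib, prod_mul_distrib, ← Real.exp_sum, hA x h, Real.exp_neg, iidLaw]
            field_simp
  have hterm : ∀ (x : Fin l → U) (y : Fin l → V),
      Q x * prodExt l W x y *
        (((M : ℝ) - 1) * ((∑ x', Q x' * prodExt l q x' y ^ s) / prodExt l q x y ^ s)) ^ ρ ≤
      K ^ 2 * ((M : ℝ) - 1) ^ ρ *
        ∏ j, (P (x j) * W (x j) (y j) * tiltedRatio q P s a ρ (x j) (y j)) := by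
    intro x y
    have hR : 0 ≤ K ^ 2 * ((M : ℝ) - 1) ^ ρ *
        ∏ j, (P (x j) * W (x j) (y j) * tiltedRatio q P s a ρ (x j) (y j)) := by
      refine mul_nonneg (mul_nonneg (sq_nonneg _) (Real.rpow_nonneg hM1 _)) ?_
      exact prod_nonneg fun _ _ => mul_nonneg (mul_nonneg (hP _) (hW _ _))
        (tiltedRatio_nonneg hq hP _ _ _ _ _)
    by_cases h : Q x = 0
    · simpa [h] using hR
    rcases (prodExt_nonneg hW l x y).eq_or_lt with h0 | h0
    · simpa [← h0] using hR
    have hqpos : ∀ j, 0 < q (x j) (y j) := fun j => hWq _ _ (pos_of_prodExt_pos hW h0 j)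
    have hratio : (∑ x', Q x' * prodExt l q x' y ^ s) / prodExt l q x y ^ s ≤
        K * ∏ j, (G (y j) / (q (x j) (y j) ^ s * Real.exp (a (x j)))) := by
      have hden : 0 < ∏ j, q (x j) (y j) ^ s := prod_pos fun j _ => Real.rpow_pos_of_pos (hqpos j) _
      rw [hpow, prod_div_distrib, prod_mul_distrib, ← Real.exp_sum, hA x h, div_le_iff₀ hden]
      refine (hS y).trans (le_of_eq ?_)
      rw [Real.exp_neg]
      field_simp
    have hbase : 0 ≤ (∑ x', Q x' * prodExt l q x' y ^ s) / prodExt l q x y ^ s :=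
      div_nonneg (sum_nonneg fun _ _ => mul_nonneg (hQ _)
        (Real.rpow_nonneg (prodExt_nonneg hq _ _ _) _))
        (Real.rpow_nonneg (prodExt_nonneg hq _ _ _) _)
    have hfac : ∀ j, 0 ≤ G (y j) / (q (x j) (y j) ^ s * Real.exp (a (x j))) := fun j =>
      div_nonneg (hG0 _) (mul_nonneg (Real.rpow_nonneg (hq _ _) _) (Real.exp_pos _).le)
    have hrpow : (((M : ℝ) - 1) *
        ((∑ x', Q x' * prodExt l q x' y ^ s) / prodExt l q x y ^ s)) ^ ρ ≤
        ((M : ℝ) - 1) ^ ρ * (K * ∏ j, tiltedRatio q P s a ρ (x j) (y j)) := by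
      rw [Real.mul_rpow hM1 hbase]
      refine mul_le_mul_of_nonneg_left ?_ (Real.rpow_nonneg hM1 _)
      calc _ ≤ (K * ∏ j, (G (y j) / (q (x j) (y j) ^ s * Real.exp (a (x j))))) ^ ρ :=
            Real.rpow_le_rpow hbase hratio hρ
        _ = K ^ ρ * ∏ j, tiltedRatio q P s a ρ (x j) (y j) := by
            rw [Real.mul_rpow hK0 (prod_nonneg fun j _ => hfac j),
              ← Real.finsetProd_rpow _ _ fun j _ => hfac j]
            rfl
        _ ≤ K * ∏ j, tiltedRatio q P s a ρ (x j) (y j) := by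
            refine mul_le_mul_of_nonneg_right ?_
              (prod_nonneg fun _ _ => tiltedRatio_nonneg hq hP _ _ _ _ _)
            simpa using Real.rpow_le_rpow_of_exponent_le hK hρ1
    calc _ ≤ (K * iidLaw l P x * prodExt l W x y) *
            (((M : ℝ) - 1) ^ ρ * (K * ∏ j, tiltedRatio q P s a ρ (x j) (y j))) :=
          mul_le_mul (mul_le_mul_of_nonneg_right (hQP x) h0.le) hrpow
            (Real.rpow_nonneg (mul_nonneg hM1 hbase) _)
            (mul_nonneg ((hQ x).trans (hQP x)) h0.le)
      _ = _ := by
          rw [prod_mul_distrib, prod_mul_distrib, iidLaw, prodExt]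
          ring
  refine (ensembleError_le_sum_rpow (prodExt_nonneg hW l) (sum_prodExt hW1 l)
    (prodExt_nonneg hq l) (prodExt_pos_of_pos hW hWq l) hQ hQ1 hs hs1 hρ hρ1 hM).trans ?_
  refine (sum_le_sum fun x _ => sum_le_sum fun y _ => hterm x y).trans (le_of_eq ?_)
  simp only [← mul_sum]
  congr 1
  calc _ = ∑ x : Fin l → U, ∏ j, ∑ v, P (x j) * W (x j) v * tiltedRatio q P s a ρ (x j) v :=
        sum_congr rfl fun x _ => (Fintype.prod_sum fun j v =>
          P (x j) * W (x j) v * tiltedRatio q P s a ρ (x j) v).symm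
    _ = _ := by
        rw [← Fintype.prod_sum fun (_ : Fin l) u =>
          ∑ v, P u * W u v * tiltedRatio q P s a ρ u v]
        simp

/-- Second-order expansion of the single-letter factor at `ρ = 0`. -/
lemma exists_sum_tiltedRatio_le {W q : U → V → ℝ} (hW : ∀ u v, 0 ≤ W u v)
    (hW1 : ∀ u, ∑ v, W u v = 1) (hq : ∀ u v, 0 ≤ q u v) (hWq : ∀ u v, 0 < W u v → 0 < q u v)
    {P : U → ℝ} (hP : ∀ u, 0 ≤ P u) (hP1 : ∑ u, P u = 1) (s : ℝ) (a : U → ℝ) :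
    ∃ B : ℝ, 0 < B ∧ ∀ ρ : ℝ, 0 ≤ ρ → ρ * B ≤ 1 →
      ∑ u, ∑ v, P u * W u v * tiltedRatio q P s a ρ u v ≤
        Real.exp (-ρ * lmDensity W q P s a + ρ ^ 2 * B ^ 2) := by
  set g : U → V → ℝ := fun u v =>
    Real.log (q u v ^ s * Real.exp (a u) / ∑ u', P u' * (q u' v ^ s * Real.exp (a u'))) with hg
  set B := 1 + ∑ u, ∑ v, |g u v| with hB
  have hgB : ∀ u v, |g u v| ≤ B := by
    intro u v
    have h1 : |g u v| ≤ ∑ v, |g u v| :=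
      single_le_sum (f := fun v => |g u v|) (fun _ _ => abs_nonneg _) (mem_univ v)
    have h2 : ∑ v, |g u v| ≤ ∑ u, ∑ v, |g u v| :=
      single_le_sum (f := fun u => ∑ v, |g u v|)
        (fun _ _ => sum_nonneg fun _ _ => abs_nonneg _) (mem_univ u)
    linarith
  have hB0 : 0 < B := add_pos_of_pos_of_nonneg one_pos
    (sum_nonneg fun _ _ => sum_nonneg fun _ _ => abs_nonneg _)
  refine ⟨B, hB0, fun ρ hρ hρB => ?_⟩
  have hterm : ∀ u v, P u * W u v * tiltedRatio q P s a ρ u v ≤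
      P u * W u v * (1 + ρ ^ 2 * B ^ 2) - ρ * (P u * W u v * g u v) := by
    intro u v
    rcases (hP u).eq_or_lt with h0 | h0
    · simp [← h0]
    rcases (hW u v).eq_or_lt with h1 | h1
    · simp [← h1]
    have hnum : 0 < q u v ^ s * Real.exp (a u) :=
      mul_pos (Real.rpow_pos_of_pos (hWq u v h1) _) (Real.exp_pos _)
    have hden : 0 < ∑ u', P u' * (q u' v ^ s * Real.exp (a u')) :=
      sum_pos' (fun _ _ => mul_nonneg (hP _)
        (mul_nonneg (Real.rpow_nonneg (hq _ _) _) (Real.exp_pos _).le))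
        ⟨u, mem_univ u, mul_pos h0 hnum⟩
    have hexp : tiltedRatio q P s a ρ u v = Real.exp (-(ρ * g u v)) := by
      rw [tiltedRatio, Real.rpow_def_of_pos (div_pos hden hnum), hg]
      simp only
      rw [← inv_div, Real.log_inv]
      congr 1; ring
    have habs : |(-(ρ * g u v))| ≤ ρ * B := by
      rw [abs_neg, abs_mul, abs_of_nonneg hρ]
      exact mul_le_mul_of_nonneg_left (hgB u v) hρ
    have h2 := (abs_le.1 (Real.abs_exp_sub_one_sub_id_le (habs.trans hρB))).2
    have h3 : (-(ρ * g u v)) ^ 2 ≤ ρ ^ 2 * B ^ 2 := by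
      rw [← mul_pow, ← sq_abs]
      exact pow_le_pow_left₀ (abs_nonneg _) habs 2
    rw [hexp]
    have h4 : Real.exp (-(ρ * g u v)) ≤ (1 + ρ ^ 2 * B ^ 2) - ρ * g u v := by linarith
    calc _ ≤ P u * W u v * ((1 + ρ ^ 2 * B ^ 2) - ρ * g u v) :=
          mul_le_mul_of_nonneg_left h4 (mul_pos h0 h1).le
      _ = _ := by ring
  calc _ ≤ ∑ u, ∑ v, (P u * W u v * (1 + ρ ^ 2 * B ^ 2) - ρ * (P u * W u v * g u v)) :=
        sum_le_sum fun u _ => sum_le_sum fun v _ => hterm u v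
    _ = (-ρ * lmDensity W q P s a + ρ ^ 2 * B ^ 2) + 1 := by
        simp only [sum_sub_distrib, ← mul_sum, ← sum_mul, hW1, hP1, lmDensity, hg]
        ring
    _ ≤ _ := Real.add_one_le_exp _

/-- Below the LM rate, random coding has an exponentially small error probability. -/
theorem exists_ensembleError_exponent {W q : U → V → ℝ} (hW : ∀ u v, 0 ≤ W u v)
    (hW1 : ∀ u, ∑ v, W u v = 1) (hq : ∀ u v, 0 ≤ q u v) (hWq : ∀ u v, 0 < W u v → 0 < q u v)
    {P : U → ℝ} (hP : ∀ u, 0 ≤ P u) (hP1 : ∑ u, P u = 1) {s : ℝ} (hs : 0 ≤ s) (hs1 : s ≤ 1)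
    (a : U → ℝ) {r : ℝ} (hr : r < lmDensity W q P s a) :
    ∃ γ > 0, ∀ (l : ℕ) (Q : (Fin l → U) → ℝ) (K A : ℝ), (∀ x, 0 ≤ Q x) → ∑ x, Q x = 1 →
      1 ≤ K → (∀ x, Q x ≤ K * iidLaw l P x) → (∀ x, Q x ≠ 0 → ∑ j, a (x j) = A) →
      ensembleError (prodExt l W) (prodExt l q) Q ⌈Real.exp (l * r)⌉₊ ≤
        K ^ 2 * Real.exp (-(l * γ)) := by
  obtain ⟨B, hB, hexp⟩ := exists_sum_tiltedRatio_le hW hW1 hq hWq hP hP1 s a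
  set I := lmDensity W q P s a
  have hI : 0 < I - r := sub_pos.2 hr
  -- For this `ρ` the linear gain `ρ (I - r)` is at least twice the quadratic loss `ρ² B²`.
  obtain ⟨ρ, hρ, hρ1, hρB, hρI⟩ : ∃ ρ : ℝ, 0 < ρ ∧ ρ ≤ 1 ∧ ρ * B ≤ 1 ∧ ρ * B ^ 2 ≤ (I - r) / 2 := by
    refine ⟨min 1 (min (1 / B) ((I - r) / 2 / B ^ 2)), by positivity, min_le_left _ _, ?_, ?_⟩
    · rw [← le_div_iff₀ hB]; exact (min_le_right _ _).trans (min_le_left _ _)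
    · rw [← le_div_iff₀ (by positivity)]; exact (min_le_right _ _).trans (min_le_right _ _)
  refine ⟨ρ * (I - r) / 2, by positivity, fun l Q K A hQ hQ1 hK hQP hA => ?_⟩
  have hM : 0 < ⌈Real.exp (l * r)⌉₊ := Nat.ceil_pos.2 (Real.exp_pos _)
  have hM1 : (0 : ℝ) ≤ (⌈Real.exp (l * r)⌉₊ : ℝ) - 1 := by
    have : (1 : ℝ) ≤ ⌈Real.exp (l * r)⌉₊ := by exact_mod_cast hM
    linarith
  have hM2 : (⌈Real.exp (l * r)⌉₊ : ℝ) - 1 ≤ Real.exp (l * r) := by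
    linarith [(Nat.ceil_lt_add_one (Real.exp_pos (l * r)).le).le]
  refine (ensembleError_block_le hW hW1 hq hWq hP hs hs1 hρ.le hρ1 a hQ hQ1 hK hQP hA hM).trans ?_
  rw [mul_assoc]
  refine mul_le_mul_of_nonneg_left ?_ (sq_nonneg K)
  have h0 : 0 ≤ ∑ u, ∑ v, P u * W u v * tiltedRatio q P s a ρ u v :=
    sum_nonneg fun _ _ => sum_nonneg fun _ _ => mul_nonneg (mul_nonneg (hP _) (hW _ _))
      (tiltedRatio_nonneg hq hP _ _ _ _ _)
  calc _ ≤ Real.exp (l * r) ^ ρ * Real.exp (-ρ * I + ρ ^ 2 * B ^ 2) ^ l :=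
        mul_le_mul (Real.rpow_le_rpow hM1 hM2 hρ.le)
          (pow_le_pow_left₀ h0 (hexp ρ hρ.le hρB) l) (pow_nonneg h0 _)
          (Real.rpow_nonneg (Real.exp_pos _).le _)
    _ = Real.exp (l * (ρ * (r - I + ρ * B ^ 2))) := by
        rw [← Real.exp_mul, ← Real.exp_nat_mul, ← Real.exp_add]
        congr 1; ring
    _ ≤ _ := by
        rw [Real.exp_le_exp, ← mul_neg]
        refine mul_le_mul_of_nonneg_left ?_ (Nat.cast_nonneg l)
        nlinarith

end Blocks

/-! ### Type classes -/

section TypeClass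

variable {U : Type*} [Fintype U]

lemma mem_typeClass [DecidableEq U] {l : ℕ} {N : U → ℕ} {x : Fin l → U} :
    x ∈ typeClass l N ↔ ∀ u, (univ.filter fun j => x j = u).card = N u := by
  simp only [typeClass, mem_filter, mem_univ, true_and]
  refine forall_congr' fun u => ?_
  rw [iff_iff_eq]
  congr!

lemma cons_mem_typeClass [DecidableEq U] {l : ℕ} {N : U → ℕ} {u : U} {x : Fin l → U} :
    (Fin.cons u x : Fin (l + 1) → U) ∈ typeClass (l + 1) N ↔
      N u ≠ 0 ∧ x ∈ typeClass l (Function.update N u (N u - 1)) := by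
  simp only [mem_typeClass, Fin.card_filter_univ_succ, Fin.cons_zero, Fin.cons_succ]
  constructor
  · intro h
    have hu := h u
    rw [if_pos rfl] at hu
    refine ⟨by omega, fun v => ?_⟩
    rcases eq_or_ne v u with rfl | hv
    · rw [Function.update_self]; omega
    · have := h v
      rw [if_neg hv.symm] at this
      rw [Function.update_of_ne hv, this]
  · rintro ⟨h0, h⟩ v
    have hv' := h v
    rcases eq_or_ne v u with rfl | hv
    · rw [Function.update_self] at hv'
      rw [if_pos rfl]; omega
    · rw [Function.update_of_ne hv] at hv'
      rw [if_neg hv.symm, hv']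

/-- A type class has multinomially many elements. -/
theorem card_typeClass_mul_prod_factorial (l : ℕ) (N : U → ℕ) (hN : ∑ u, N u = l) :
    (typeClass l N).card * ∏ u, (N u).factorial = l.factorial := by
  classical
  induction l generalizing N with
  | zero =>
    have h0 : ∀ u, N u = 0 := fun u => by simpa using (sum_eq_zero_iff.1 hN) u (mem_univ u)
    have : typeClass 0 N = univ := by
      ext x; simpa [mem_typeClass, h0] using Subsingleton.elim x default
    rw [this]; simp [h0]
  | succ l ih =>
    have hcard : (typeClass (l + 1) N).card =
        ∑ u, if N u ≠ 0 then (typeClass l (Function.update N u (N u - 1))).card else 0 := by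
      have hsum : ∀ (n : ℕ) (T : Finset (Fin n → U)), T.card = ∑ x, if x ∈ T then 1 else 0 := by
        intro n T; simp
      rw [hsum, ← (Fin.consEquiv fun _ => U).sum_comp, Fintype.sum_prod_type]
      refine sum_congr rfl fun u _ => ?_
      have hmem : ∀ x : Fin l → U, (Fin.consEquiv fun _ => U) (u, x) ∈ typeClass (l + 1) N ↔
          N u ≠ 0 ∧ x ∈ typeClass l (Function.update N u (N u - 1)) := fun _ => cons_mem_typeClass
      simp only [hmem]
      split_ifs with h
      · rw [hsum]; simp [h]
      · simp [h]
    rw [hcard, sum_mul, Nat.factorial_succ, ← hN, sum_mul]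
    refine sum_congr rfl fun u _ => ?_
    by_cases h : N u = 0
    · simp [h]
    rw [if_pos h]
    have hsum : ∑ v, Function.update N u (N u - 1) v = l := by
      rw [sum_update_of_mem (mem_univ u), sdiff_singleton_eq_erase]
      rw [← add_sum_erase univ N (mem_univ u)] at hN
      omega
    rw [← ih _ hsum]
    have hprod : ∏ v, (N v).factorial =
        N u * ∏ v, (Function.update N u (N u - 1) v).factorial := by
      rw [← mul_prod_erase univ _ (mem_univ u), ← mul_prod_erase univ
        (fun v => (Function.update N u (N u - 1) v).factorial) (mem_univ u), ← mul_assoc,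
        Function.update_self, Nat.mul_factorial_pred h]
      congr 1
      refine prod_congr rfl fun v hv => ?_
      rw [Function.update_of_ne (ne_of_mem_erase hv)]
    rw [hprod]; ring

lemma typeClass_card_pos {l : ℕ} {N : U → ℕ} (hN : ∑ u, N u = l) : 0 < (typeClass l N).card :=
  Nat.pos_of_ne_zero fun h => l.factorial_ne_zero <| by
    rw [← card_typeClass_mul_prod_factorial l N hN, h, zero_mul]

lemma constCompLaw_nonneg (l : ℕ) (N : U → ℕ) (x : Fin l → U) : 0 ≤ constCompLaw l N x := by
  rw [constCompLaw]; split_ifs <;> positivity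

lemma sum_constCompLaw {l : ℕ} {N : U → ℕ} (hN : ∑ u, N u = l) :
    ∑ x, constCompLaw l N x = 1 := by
  have : ((typeClass l N).card : ℝ) ≠ 0 := by exact_mod_cast (typeClass_card_pos hN).ne'
  simp only [constCompLaw, sum_ite_mem, univ_inter, sum_const, nsmul_eq_mul]
  field_simp

lemma prod_eq_prod_pow_of_mem_typeClass {l : ℕ} {N : U → ℕ} {x : Fin l → U}
    (hx : x ∈ typeClass l N) (f : U → ℝ) : ∏ j, f (x j) = ∏ u, f u ^ N u := by
  classical
  rw [mem_typeClass] at hx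
  rw [← prod_fiberwise_of_maps_to (g := x) (t := univ) (fun _ _ => mem_univ _)]
  refine prod_congr rfl fun u _ => ?_
  rw [prod_congr rfl (g := fun _ => f u) (by intro j hj; rw [(mem_filter.1 hj).2]), prod_const,
    hx u]

lemma sum_eq_sum_mul_of_mem_typeClass {l : ℕ} {N : U → ℕ} {x : Fin l → U}
    (hx : x ∈ typeClass l N) (f : U → ℝ) : ∑ j, f (x j) = ∑ u, N u * f u := by
  classical
  rw [mem_typeClass] at hx
  rw [← sum_fiberwise_of_maps_to (g := x) (t := univ) (fun _ _ => mem_univ _)]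
  refine sum_congr rfl fun u _ => ?_
  rw [sum_congr rfl (g := fun _ => f u) (by intro j hj; rw [(mem_filter.1 hj).2]), sum_const,
    hx u, nsmul_eq_mul]

/-- A Stirling upper bound valid for all positive `n`, namely `n! ≤ e n (n / e) ^ n`. -/
lemma log_factorial_le {n : ℕ} (hn : 1 ≤ n) :
    Real.log n.factorial ≤ (n + 1) * Real.log n - n + 1 := by
  induction n, hn using Nat.le_induction with
  | base => simp
  | succ n hn ih =>
    have hn0 : (0 : ℝ) < n := by exact_mod_cast hn
    have h1 : 1 - (((n : ℝ) + 1) / n)⁻¹ ≤ Real.log (((n : ℝ) + 1) / n) :=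
      Real.one_sub_inv_le_log_of_pos (by positivity)
    rw [Real.log_div (by positivity) hn0.ne', inv_div] at h1
    have h2 : 1 - (n : ℝ) / (n + 1) = 1 / (n + 1) := by field_simp; ring
    rw [h2, div_le_iff₀ (by positivity)] at h1
    rw [Nat.factorial_succ, Nat.cast_mul, Real.log_mul (by positivity) (by positivity)]
    push_cast
    nlinarith

/-- Stirling bound on the size of a type class. -/
lemma neg_log_card_typeClass_le {l : ℕ} (hl : l ≠ 0) {N : U → ℕ} (hN : ∑ u, N u = l) :
    -Real.log (typeClass l N).card ≤
      ∑ u, N u * Real.log (N u / l) + Fintype.card U * (1 + Real.log (l + 1)) := by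
  have hl0 : (0 : ℝ) < l := by positivity
  have hlog : Real.log (typeClass l N).card + ∑ u, Real.log (N u).factorial =
      Real.log l.factorial := by
    rw [← card_typeClass_mul_prod_factorial l N hN, Nat.cast_mul, Nat.cast_prod,
      Real.log_mul (by exact_mod_cast (typeClass_card_pos hN).ne')
        (prod_ne_zero_iff.2 fun u _ => by positivity),
      Real.log_prod fun u _ => by positivity]
  have h1 : l * Real.log l - l ≤ Real.log l.factorial := by
    have := Stirling.le_log_factorial_stirling hl
    have h2 : 0 ≤ Real.log l := Real.log_natCast_nonneg l
    have h3 : 0 ≤ Real.log (2 * Real.pi) := Real.log_nonneg (by linarith [Real.pi_gt_three])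
    linarith
  have hle : ∀ u, N u ≤ l := fun u => hN ▸ single_le_sum (f := N) (fun _ _ => Nat.zero_le _)
    (mem_univ u)
  have h2 : ∀ u, Real.log (N u).factorial ≤
      N u * Real.log (N u / l) + N u * (Real.log l - 1) + (1 + Real.log (l + 1)) := by
    intro u
    rcases Nat.eq_zero_or_pos (N u) with h | h
    · have : 0 ≤ Real.log ((l : ℝ) + 1) := Real.log_nonneg (by linarith)
      simp only [h]; simp; linarith
    · have hpos : (0 : ℝ) < N u := by exact_mod_cast h
      have h3 := log_factorial_le h
      have h4 : Real.log (N u) ≤ Real.log (l + 1) := Real.log_le_log hpos <| by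
        have : (N u : ℝ) ≤ l := by exact_mod_cast hle u
        linarith
      rw [Real.log_div hpos.ne' hl0.ne']
      linarith
  have h3 := sum_le_sum fun u (_ : u ∈ univ) => h2 u
  have hN' : ∑ u, (N u : ℝ) = l := by exact_mod_cast hN
  rw [sum_add_distrib, sum_add_distrib, ← sum_mul, hN', sum_const, card_univ, nsmul_eq_mul] at h3
  linarith

/-- The uniform law on the type classes of types converging to `P`, with support in that of `P`,
is dominated by the i.i.d. law with distribution `P` up to a subexponential factor. -/
theorem exists_constCompLaw_le {P : U → ℝ} (hP : ∀ u, 0 ≤ P u) {N : ℕ → U → ℕ}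
    (hN : ∀ l, ∑ u, N l u = l) (hN0 : ∀ l u, P u = 0 → N l u = 0)
    (hlim : ∀ u, Tendsto (fun l => (N l u : ℝ) / l) atTop (𝓝 (P u))) :
    ∃ κ : ℕ → ℝ, Tendsto (fun l => κ l / l) atTop (𝓝 0) ∧
      ∀ l, l ≠ 0 → ∀ x, constCompLaw l (N l) x ≤ Real.exp (κ l) * iidLaw l P x := by
  -- The first term is `l` times the relative entropy of the type with respect to `P`.
  refine ⟨fun l => ∑ u, N l u * (Real.log (N l u / l) - Real.log (P u)) +
    Fintype.card U * (1 + Real.log (l + 1)), ?_, fun l hl x => ?_⟩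
  · have h1 : ∀ u, Tendsto (fun l : ℕ => (N l u / l : ℝ) *
        (Real.log (N l u / l) - Real.log (P u))) atTop (𝓝 0) := by
      intro u
      rcases (hP u).eq_or_lt with h | h
      · simp [hN0 _ u h.symm]
      · have := (hlim u).mul (((hlim u).log h.ne').sub_const (Real.log (P u)))
        simpa using this
    have h2 : Tendsto (fun l : ℕ => Real.log ((l : ℝ) + 1) / l) atTop (𝓝 0) := by
      have h3 : Tendsto (fun x : ℝ => Real.log x / x) atTop (𝓝 0) := by
        simpa using Real.isLittleO_log_id_atTop.tendsto_div_nhds_zero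
      have h4 := (h3.comp (tendsto_natCast_atTop_atTop (R := ℝ))).comp (tendsto_add_atTop_nat 1)
      have h5 : Tendsto (fun l : ℕ => ((l : ℝ) + 1) / l) atTop (𝓝 1) := by
        have := (tendsto_const_div_atTop_nhds_zero_nat (1 : ℝ)).const_add 1
        rw [add_zero] at this
        refine this.congr' ?_
        filter_upwards [eventually_ne_atTop 0] with l hl
        field_simp
      have := h4.mul h5
      rw [zero_mul] at this
      refine this.congr fun l => ?_
      have : (l : ℝ) + 1 ≠ 0 := by positivity
      simp only [Function.comp, Nat.cast_add, Nat.cast_one]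
      field_simp
    have h3 := (tendsto_finsetSum univ fun u _ => h1 u).add
      (((tendsto_const_div_atTop_nhds_zero_nat (1 : ℝ)).add h2).const_mul (Fintype.card U : ℝ))
    simp only [sum_const_zero, add_zero, mul_zero] at h3
    refine h3.congr fun l => ?_
    rw [add_div, sum_div, ← add_div, mul_div_assoc]
    congr 1
    exact sum_congr rfl fun u _ => by ring
  · have hP0 : 0 ≤ iidLaw l P x := prod_nonneg fun _ _ => hP _
    rw [constCompLaw]
    split_ifs with hx
    swap
    · exact mul_nonneg (Real.exp_pos _).le hP0
    have hT : (0 : ℝ) < (typeClass l (N l)).card := by exact_mod_cast typeClass_card_pos (hN l)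
    have hiid : iidLaw l P x = Real.exp (∑ u, N l u * Real.log (P u)) := by
      rw [iidLaw, prod_eq_prod_pow_of_mem_typeClass hx, Real.exp_sum]
      refine prod_congr rfl fun u _ => ?_
      rcases (hP u).eq_or_lt with h | h
      · simp [hN0 l u h.symm]
      · rw [Real.exp_nat_mul, Real.exp_log h]
    rw [hiid, ← Real.exp_add, one_div, ← Real.exp_log (inv_pos.2 hT), Real.exp_le_exp,
      Real.log_inv]
    refine (neg_log_card_typeClass_le hl (hN l)).trans (le_of_eq ?_)
    simp only [mul_sub, sum_sub_distrib]
    ring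

/-- Every distribution is a limit of types with smaller support. -/
theorem exists_types_tendsto {P : U → ℝ} (hP : ∀ u, 0 ≤ P u) (hP1 : ∑ u, P u = 1) :
    ∃ N : ℕ → U → ℕ, (∀ l, ∑ u, N l u = l) ∧ (∀ l u, P u = 0 → N l u = 0) ∧
      ∀ u, Tendsto (fun l => (N l u : ℝ) / l) atTop (𝓝 (P u)) := by
  classical
  -- Round all counts down, except at one letter of the support, which absorbs the remainder.
  obtain ⟨u₀, hu₀⟩ : ∃ u, P u ≠ 0 := by
    by_contra! h
    simp [h] at hP1
  have hP1' : P u₀ + ∑ u ∈ univ.erase u₀, P u = 1 := by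
    rw [add_sum_erase univ P (mem_univ u₀), hP1]
  have hle : ∀ l : ℕ, ∑ u ∈ univ.erase u₀, ⌊P u * l⌋₊ ≤ l := by
    intro l
    have h1 : ∑ u ∈ univ.erase u₀, (⌊P u * l⌋₊ : ℝ) ≤ ∑ u ∈ univ.erase u₀, P u * l :=
      sum_le_sum fun u _ => Nat.floor_le (mul_nonneg (hP u) (Nat.cast_nonneg l))
    rw [← sum_mul] at h1
    have h2 : (∑ u ∈ univ.erase u₀, P u) * l ≤ 1 * l :=
      mul_le_mul_of_nonneg_right (by linarith [hP u₀]) (Nat.cast_nonneg l)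
    have h3 := h1.trans h2
    rw [one_mul] at h3
    exact_mod_cast h3
  have hfloor : ∀ u, Tendsto (fun l : ℕ => (⌊P u * l⌋₊ : ℝ) / l) atTop (𝓝 (P u)) := fun u =>
    (tendsto_nat_floor_mul_div_atTop (hP u)).comp (tendsto_natCast_atTop_atTop (R := ℝ))
  refine ⟨fun l u => if u = u₀ then l - ∑ u ∈ univ.erase u₀, ⌊P u * l⌋₊ else ⌊P u * l⌋₊,
    fun l => ?_, fun l u hu => ?_, fun u => ?_⟩
  · rw [← add_sum_erase univ _ (mem_univ u₀)]
    simp only [if_true]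
    rw [sum_congr rfl fun u hu => if_neg (ne_of_mem_erase hu)]
    exact Nat.sub_add_cancel (hle l)
  · have : u ≠ u₀ := fun h => hu₀ (h ▸ hu)
    simp [this, hu]
  · by_cases h : u = u₀
    · subst h
      simp only [if_true]
      have h1 := (tendsto_finsetSum (univ.erase u) fun v _ => hfloor v).const_sub 1
      rw [show 1 - ∑ v ∈ univ.erase u, P v = P u by linarith] at h1
      refine h1.congr' ?_
      filter_upwards [eventually_ne_atTop 0] with l hl
      have : (l : ℝ) ≠ 0 := by positivity
      rw [Nat.cast_sub (hle l), Nat.cast_sum, sub_div, div_self this, sum_div]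
    · simpa [h] using hfloor u

end TypeClass

/-! ### Achievability by product-space random coding -/

section Expurgation

variable {U V : Type*} [Fintype V]

/-- A message whose codeword is repeated is decoded correctly with probability at most `1 / 2`. -/
lemma half_le_messageError_of_eq {W q : U → V → ℝ} (hW : ∀ u v, 0 ≤ W u v)
    (hW1 : ∀ u, ∑ v, W u v = 1) (hq : ∀ u v, 0 ≤ q u v) (hWq : ∀ u v, 0 < W u v → 0 < q u v)
    {M : ℕ} {c : Fin M → U} {m m' : Fin M} (hne : m ≠ m') (h : c m = c m') :
    1 / 2 ≤ messageError W q c m := by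
  have hle : ∑ v, W (c m) v * (1 / 2) ≤ messageError W q c m := by
    refine sum_le_sum fun v _ => ?_
    rcases (hW (c m) v).eq_or_lt with h0 | h0
    · simp [← h0]
    have hqv := hWq _ _ h0
    refine mul_le_mul_of_nonneg_left ?_ h0.le
    have h2 : q (c m) v + q (c m) v ≤ ∑ i, q (c i) v := by
      calc q (c m) v + q (c m) v = ∑ i ∈ {m, m'}, q (c i) v := by rw [sum_pair hne, ← h]
        _ ≤ _ := sum_le_sum_of_subset_of_nonneg (subset_univ _) fun _ _ _ => hq _ _
    have h3 : decodeProb q c v m ≤ 1 / 2 := by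
      rw [decodeProb, div_le_iff₀ (by linarith)]
      linarith
    linarith
  rwa [← sum_mul, hW1, one_mul] at hle

/-- Removing codewords does not increase the error probability of the remaining messages. -/
lemma messageError_comp_le {W q : U → V → ℝ} (hW : ∀ u v, 0 ≤ W u v) (hq : ∀ u v, 0 ≤ q u v)
    (hWq : ∀ u v, 0 < W u v → 0 < q u v) {M M' : ℕ} (c : Fin M → U) (f : Fin M' ↪ Fin M)
    (i : Fin M') : messageError W q (c ∘ f) i ≤ messageError W q c (f i) := by
  refine sum_le_sum fun v _ => ?_
  rcases (hW (c (f i)) v).eq_or_lt with h0 | h0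
  · simp [← h0]
  refine mul_le_mul_of_nonneg_left (sub_le_sub_left ?_ _) h0.le
  refine div_le_div_of_nonneg_left (hq _ _) ?_ ?_
  · exact (hWq _ _ h0).trans_le
      (single_le_sum (f := fun i => q ((c ∘ f) i) v) (fun _ _ => hq _ _) (mem_univ i))
  · calc ∑ j, q ((c ∘ f) j) v = ∑ m ∈ univ.map f, q (c m) v := by simp
      _ ≤ _ := sum_le_sum_of_subset_of_nonneg (subset_univ _) fun _ _ _ => hq _ _

/-- A good code contains a good code with at least half of its messages and with distinct
codewords: the messages with error probability below `1 / 2` have unrepeated codewords. -/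
theorem exists_injective_code {W q : U → V → ℝ} (hW : ∀ u v, 0 ≤ W u v)
    (hW1 : ∀ u, ∑ v, W u v = 1) (hq : ∀ u v, 0 ≤ q u v) (hWq : ∀ u v, 0 < W u v → 0 < q u v)
    {M : ℕ} (hM : 0 < M) (c : Fin M → U) (herr : errorProb W q c ≤ 1 / 4) :
    ∃ (M' : ℕ) (c' : Fin M' → U), 0 < M' ∧ M ≤ 2 * M' ∧ Function.Injective c' ∧
      errorProb W q c' ≤ 2 * errorProb W q c := by
  have hM0 : (0 : ℝ) < M := by exact_mod_cast hM
  have hnn := messageError_nonneg hW hq c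
  have hsum : ∑ m, messageError W q c m = M * errorProb W q c := by
    rw [errorProb_eq_average hW1 hM]; field_simp
  set S := univ.filter fun m => messageError W q c m < 1 / 2 with hS
  set T := univ.filter fun m => ¬ messageError W q c m < 1 / 2 with hT
  have hST : S.card + T.card = M := by
    rw [hS, hT, card_filter_add_card_filter_not, card_univ, Fintype.card_fin]
  have hTle : (T.card : ℝ) * (1 / 2) ≤ M * errorProb W q c := by
    rw [← hsum, ← nsmul_eq_mul]
    refine (card_nsmul_le_sum T _ _ fun m hm => not_lt.1 (mem_filter.1 hm).2).trans ?_
    exact sum_le_sum_of_subset_of_nonneg (subset_univ _) fun _ _ _ => hnn _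
  have hSM : M ≤ 2 * S.card := by
    have h1 : (S.card : ℝ) + T.card = M := by exact_mod_cast hST
    have h2 : (M : ℝ) * errorProb W q c ≤ M * (1 / 4) := mul_le_mul_of_nonneg_left herr hM0.le
    have h3 : (M : ℝ) ≤ 2 * S.card := by linarith
    exact_mod_cast h3
  have hS0 : 0 < S.card := by omega
  set f : Fin S.card ↪ Fin M := (S.orderEmbOfFin rfl).toEmbedding with hf
  have hfS : ∀ i, f i ∈ S := fun i => S.orderEmbOfFin_mem rfl i
  refine ⟨S.card, c ∘ f, hS0, hSM, fun i j hij => ?_, ?_⟩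
  · by_contra hne
    exact absurd (mem_filter.1 (hfS i)).2
      (not_lt.2 (half_le_messageError_of_eq hW hW1 hq hWq (f.injective.ne hne) hij))
  · have h1 : ∑ i, messageError W q (c ∘ f) i ≤ M * errorProb W q c := by
      rw [← hsum]
      calc ∑ i, messageError W q (c ∘ f) i ≤ ∑ i, messageError W q c (f i) :=
            sum_le_sum fun i _ => messageError_comp_le hW hq hWq c f i
        _ = ∑ m ∈ univ.map f, messageError W q c m := by simp
        _ ≤ _ := sum_le_sum_of_subset_of_nonneg (subset_univ _) fun _ _ _ => hnn _
    have h2 : (M : ℝ) ≤ 2 * S.card := by exact_mod_cast hSM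
    have h3 : (0 : ℝ) < S.card := by exact_mod_cast hS0
    rw [errorProb_eq_average hW1 hS0, one_div, inv_mul_le_iff₀ h3]
    refine h1.trans ?_
    have := mul_le_mul_of_nonneg_right h2 (errorProb_nonneg hW hW1 hq hM c)
    linarith

/-- Uninformative channel uses, whose inputs do not depend on the message, do not change the
error probability. -/
lemma errorProb_eq_of_factor {U' V' T : Type*} [Fintype V'] [Fintype T] {W q : U → V → ℝ}
    {W' q' : U' → V' → ℝ} (e : V' ≃ V × T) {w r : T → ℝ} (hw : ∀ t, 0 ≤ w t)
    (hw1 : ∑ t, w t = 1) (hwr : ∀ t, 0 < w t → 0 < r t) {M : ℕ} {c : Fin M → U}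
    {c' : Fin M → U'} (hW' : ∀ m y, W' (c' m) y = W (c m) (e y).1 * w (e y).2)
    (hq' : ∀ m y, q' (c' m) y = q (c m) (e y).1 * r (e y).2) :
    errorProb W' q' c' = errorProb W q c := by
  simp only [errorProb, decodeProb, hW', hq']
  congr 2
  refine sum_congr rfl fun m _ => ?_
  rw [e.sum_comp fun p => W (c m) p.1 * w p.2 *
    (q (c m) p.1 * r p.2 / ∑ m', q (c m') p.1 * r p.2), Fintype.sum_prod_type]
  refine sum_congr rfl fun v _ => ?_
  calc _ = ∑ t, w t * (W (c m) v * (q (c m) v / ∑ m', q (c m') v)) := by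
        refine sum_congr rfl fun t _ => ?_
        rcases (hw t).eq_or_lt with h | h
        · simp [← h]
        · simp only
          rw [← sum_mul, mul_div_mul_right _ _ (hwr t h).ne']
          ring
    _ = _ := by rw [← sum_mul, hw1, one_mul]

end Expurgation

section Padding

variable {X Y : Type*}

/-- Splitting a sequence into `l` blocks of length `k` and a remainder of length `r`. -/
def splitEquiv {l k r n : ℕ} (ι : (Fin l × Fin k) ⊕ Fin r ≃ Fin n) (Y : Type*) :
    (Fin n → Y) ≃ (Fin l → Fin k → Y) × (Fin r → Y) where
  toFun y := (fun a b => y (ι (.inl (a, b))), fun j => y (ι (.inr j)))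
  invFun p i := Sum.elim (fun ab : Fin l × Fin k => p.1 ab.1 ab.2) p.2 (ι.symm i)
  left_inv y := by
    funext i
    obtain ⟨j, rfl⟩ := ι.surjective i
    rcases j with ⟨a, b⟩ | j <;> simp
  right_inv p := by simp

lemma prodExt_eq_mul {l k r n : ℕ} (ι : (Fin l × Fin k) ⊕ Fin r ≃ Fin n) (w : X → Y → ℝ)
    (x : Fin n → X) (y : Fin n → Y) :
    prodExt n w x y = prodExt l (prodExt k w) (splitEquiv ι X x).1 (splitEquiv ι Y y).1 *
      prodExt r w (splitEquiv ι X x).2 (splitEquiv ι Y y).2 := by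
  simp only [prodExt, splitEquiv, Equiv.coe_fn_mk]
  rw [← ι.prod_comp, Fintype.prod_sum_type, Fintype.prod_prod_type]

/-- Padding a block code with a constant letter gives a code of arbitrary length `n` with the
same error probability. -/
lemma exists_padded_code [Nonempty X] [Fintype Y] {W q : X → Y → ℝ} (hW : ∀ x y, 0 ≤ W x y)
    (hW1 : ∀ x, ∑ y, W x y = 1) (hWq : ∀ x y, 0 < W x y → 0 < q x y) (k n : ℕ) {M : ℕ}
    {c : Fin M → Fin (n / k) → Fin k → X} (hc : Function.Injective c) :
    ∃ c' : Fin M → Fin n → X, Function.Injective c' ∧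
      errorProb (prodExt n W) (prodExt n q) c' =
        errorProb (prodExt (n / k) (prodExt k W)) (prodExt (n / k) (prodExt k q)) c := by
  obtain ⟨x₀⟩ := ‹Nonempty X›
  let ι : (Fin (n / k) × Fin k) ⊕ Fin (n % k) ≃ Fin n :=
    ((finProdFinEquiv.sumCongr (Equiv.refl _)).trans finSumFinEquiv).trans
      (finCongr (Nat.div_add_mod' n k))
  refine ⟨fun m => (splitEquiv ι X).symm (c m, fun _ => x₀), fun m m' h => hc ?_, ?_⟩
  · exact congrArg Prod.fst ((splitEquiv ι X).symm.injective h)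
  · refine errorProb_eq_of_factor (splitEquiv ι Y) (w := prodExt (n % k) W fun _ => x₀)
      (r := prodExt (n % k) q fun _ => x₀) (prodExt_nonneg hW _ _) (sum_prodExt hW1 _ _)
      (prodExt_pos_of_pos hW hWq _ _) (fun m y => ?_) fun m y => ?_
    · rw [prodExt_eq_mul ι, Equiv.apply_symm_apply]
    · rw [prodExt_eq_mul ι, Equiv.apply_symm_apply]

end Padding

section Achievability

variable {X Y : Type*} [Fintype X] [Fintype Y] {W q : X → Y → ℝ}

lemma blockEnsembleError_nonneg (hW : ∀ x y, 0 ≤ W x y) (hW1 : ∀ x, ∑ y, W x y = 1)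
    (hq : ∀ x y, 0 ≤ q x y) (k l : ℕ) (R : ℝ) {Q : (Fin l → Fin k → X) → ℝ}
    (hQ : ∀ x, 0 ≤ Q x) : 0 ≤ blockEnsembleError W q k l R Q :=
  ensembleError_nonneg (prodExt_nonneg (prodExt_nonneg hW k) l)
    (sum_prodExt (sum_prodExt hW1 k) l) (prodExt_nonneg (prodExt_nonneg hq k) l) hQ
    (Nat.ceil_pos.2 (Real.exp_pos _))

/-- I.i.d. block coding achieves all rates below the GMI. -/
theorem iidAchieves_of_lt (hW : ∀ x y, 0 ≤ W x y) (hW1 : ∀ x, ∑ y, W x y = 1)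
    (hq : ∀ x y, 0 ≤ q x y) (hWq : ∀ x y, 0 < W x y → 0 < q x y) {k : ℕ}
    {P : (Fin k → X) → ℝ} (hP : P ∈ stdSimplex ℝ (Fin k → X)) {s : ℝ} (hs : 0 ≤ s) (hs1 : s ≤ 1)
    {R : ℝ} (hR : k * R < gmiDensity (prodExt k W) (prodExt k q) P s) :
    IIDAchieves W q k P R := by
  have hR' : k * R < lmDensity (prodExt k W) (prodExt k q) P s 0 := by
    simpa [lmDensity, gmiDensity] using hR
  obtain ⟨γ, hγ, h⟩ := exists_ensembleError_exponent (prodExt_nonneg hW k) (sum_prodExt hW1 k)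
    (prodExt_nonneg hq k) (prodExt_pos_of_pos hW hWq k) hP.1 hP.2 hs hs1 0 hR'
  have hiid : ∀ (l : ℕ) (x : Fin l → Fin k → X), 0 ≤ iidLaw l P x := fun l x =>
    prod_nonneg fun _ _ => hP.1 _
  refine squeeze_zero (fun l => blockEnsembleError_nonneg hW hW1 hq k l R (hiid l)) (fun l => ?_)
    (Real.tendsto_exp_atBot.comp (tendsto_neg_atTop_atBot.comp
      (tendsto_natCast_atTop_atTop.atTop_mul_const hγ)))
  have := h l (iidLaw l P) 1 0 (hiid l) (sum_iidLaw hP.2 l) le_rfl (fun x => (one_mul _).ge)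
    (fun x _ => by simp)
  rw [one_pow, one_mul] at this
  rw [blockEnsembleError, mul_right_comm, mul_comm]
  exact this

/-- Constant-composition block coding achieves all rates below the LM rate. -/
theorem constCompAchieves_of_lt (hW : ∀ x y, 0 ≤ W x y) (hW1 : ∀ x, ∑ y, W x y = 1)
    (hq : ∀ x y, 0 ≤ q x y) (hWq : ∀ x y, 0 < W x y → 0 < q x y) {k : ℕ}
    {P : (Fin k → X) → ℝ} (hP : P ∈ stdSimplex ℝ (Fin k → X)) {s : ℝ} (hs : 0 ≤ s) (hs1 : s ≤ 1)
    (a : (Fin k → X) → ℝ) {R : ℝ}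
    (hR : k * R < lmDensity (prodExt k W) (prodExt k q) P s a) :
    ConstCompAchieves W q k P R := by
  obtain ⟨γ, hγ, h⟩ := exists_ensembleError_exponent (prodExt_nonneg hW k) (sum_prodExt hW1 k)
    (prodExt_nonneg hq k) (prodExt_pos_of_pos hW hWq k) hP.1 hP.2 hs hs1 a hR
  obtain ⟨N, hN, hN0, hlim⟩ := exists_types_tendsto hP.1 hP.2
  obtain ⟨κ, hκ, hdom⟩ := exists_constCompLaw_le hP.1 hN hN0 hlim
  refine ⟨N, hN, hlim, ?_⟩
  have hzero : Tendsto (fun l : ℕ => Real.exp (-(l * (γ / 2)))) atTop (𝓝 0) :=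
    Real.tendsto_exp_atBot.comp (tendsto_neg_atTop_atBot.comp
      (tendsto_natCast_atTop_atTop.atTop_mul_const (half_pos hγ)))
  refine squeeze_zero' (Eventually.of_forall fun l =>
    blockEnsembleError_nonneg hW hW1 hq k l R (constCompLaw_nonneg l (N l))) ?_ hzero
  filter_upwards [eventually_ne_atTop 0, hκ.eventually_lt_const (show 0 < γ / 4 by positivity)]
    with l hl hκl
  have hl0 : (0 : ℝ) < l := by positivity
  rw [div_lt_iff₀ hl0] at hκl
  -- Both laws have total mass one.
  have hK : 1 ≤ Real.exp (κ l) := by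
    have := sum_le_sum fun x (_ : x ∈ univ) => hdom l hl x
    rwa [← mul_sum, sum_constCompLaw (hN l), sum_iidLaw hP.2, mul_one] at this
  have := h l (constCompLaw l (N l)) (Real.exp (κ l)) (∑ u, N l u * a u)
    (constCompLaw_nonneg l (N l)) (sum_constCompLaw (hN l)) hK (hdom l hl) fun x hx =>
      sum_eq_sum_mul_of_mem_typeClass (by by_contra hx'; exact hx (if_neg hx')) a
  rw [blockEnsembleError, mul_right_comm, mul_comm]
  refine this.trans ?_
  rw [← Real.exp_nat_mul, ← Real.exp_add, Real.exp_le_exp]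
  push_cast
  linarith

/-- Every rate achieved by constant-composition block coding is an achievable rate. -/
theorem ConstCompAchieves.isAchievable [Nonempty X] (hW : ∀ x y, 0 ≤ W x y)
    (hW1 : ∀ x, ∑ y, W x y = 1) (hq : ∀ x y, 0 ≤ q x y) (hWq : ∀ x y, 0 < W x y → 0 < q x y)
    {k : ℕ} (hk : k ≠ 0) {P : (Fin k → X) → ℝ} {R : ℝ} (h : ConstCompAchieves W q k P R) :
    IsAchievable W q R := by
  obtain ⟨N, hN, -, hE⟩ := h
  set E : ℕ → ℝ := fun l => blockEnsembleError W q k l R (constCompLaw l (N l)) with hEdef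
  have hcode : ∀ n : ℕ, ∃ (M : ℕ) (c : Fin M → Fin n → X), 0 < M ∧ Function.Injective c ∧
      (E (n / k) ≤ 1 / 4 → ⌈Real.exp (k * (n / k : ℕ) * R)⌉₊ ≤ 2 * M ∧
        errorProb (prodExt n W) (prodExt n q) c ≤ 2 * E (n / k)) := by
    intro n
    by_cases hn : E (n / k) ≤ 1 / 4
    · obtain ⟨c, hc⟩ := exists_errorProb_le_ensembleError (prodExt (n / k) (prodExt k W))
        (prodExt (n / k) (prodExt k q)) (constCompLaw_nonneg (n / k) (N (n / k)))
        (sum_constCompLaw (hN (n / k))) ⌈Real.exp (k * (n / k : ℕ) * R)⌉₊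
      change _ ≤ E (n / k) at hc
      obtain ⟨M, c', hM, hMM, hinj, hc'⟩ := exists_injective_code
        (prodExt_nonneg (prodExt_nonneg hW k) (n / k)) (sum_prodExt (sum_prodExt hW1 k) (n / k))
        (prodExt_nonneg (prodExt_nonneg hq k) (n / k))
        (prodExt_pos_of_pos (prodExt_nonneg hW k) (prodExt_pos_of_pos hW hWq k) (n / k))
        (Nat.ceil_pos.2 (Real.exp_pos _)) c (hc.trans hn)
      obtain ⟨c'', hinj'', hc''⟩ := exists_padded_code hW hW1 hWq k n hinj
      exact ⟨M, c'', hM, hinj'', fun _ => ⟨hMM, by rw [hc'']; linarith⟩⟩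
    · -- At the finitely many remaining lengths, any one-word code will do.
      obtain ⟨x₀⟩ := ‹Nonempty X›
      exact ⟨1, fun _ _ => x₀, one_pos, fun _ _ _ => Subsingleton.elim _ _, fun h => absurd h hn⟩
  choose M c hM hinj hgood using hcode
  have hEk : Tendsto (fun n => E (n / k)) atTop (𝓝 0) :=
    hE.comp (Nat.tendsto_div_const_atTop hk)
  have hev : ∀ᶠ n in atTop, E (n / k) ≤ 1 / 4 := hEk.eventually_le_const (by norm_num)
  refine ⟨M, c, hM, hinj, ?_, ?_⟩
  · have hlim : Tendsto (fun n : ℕ => ((R - (k * |R| + Real.log 2) / n : ℝ) : EReal)) atTop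
        (𝓝 (R : EReal)) := by
      refine (continuous_coe_real_ereal.tendsto R).comp ?_
      simpa using (tendsto_const_div_atTop_nhds_zero_nat (k * |R| + Real.log 2)).const_sub R
    rw [← hlim.liminf_eq]
    refine liminf_le_liminf ?_
    filter_upwards [hev, eventually_ne_atTop 0] with n hn hn0
    have hn0' : (0 : ℝ) < n := by positivity
    have hMpos : (0 : ℝ) < M n := by exact_mod_cast hM n
    have h1 : Real.exp (k * (n / k : ℕ) * R) ≤ 2 * M n :=
      (Nat.le_ceil _).trans (by exact_mod_cast (hgood n hn).1)
    have h2 := Real.log_le_log (Real.exp_pos _) h1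
    rw [Real.log_exp, Real.log_mul two_ne_zero hMpos.ne'] at h2
    have h3 : ((k : ℝ) * (n / k : ℕ)) = n - (n % k : ℕ) := by
      have : (k : ℝ) * (n / k : ℕ) + (n % k : ℕ) = n := by exact_mod_cast Nat.div_add_mod n k
      linarith
    have h4 : ((n % k : ℕ) : ℝ) * R ≤ k * |R| :=
      (mul_le_mul_of_nonneg_left (le_abs_self R) (Nat.cast_nonneg _)).trans
        (mul_le_mul_of_nonneg_right
          (by exact_mod_cast (Nat.mod_lt n (Nat.pos_of_ne_zero hk)).le) (abs_nonneg R))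
    rw [EReal.coe_le_coe_iff, le_div_iff₀ hn0', sub_mul, div_mul_cancel₀ _ hn0'.ne']
    rw [h3] at h2
    linarith
  · have h2E : Tendsto (fun n => 2 * E (n / k)) atTop (𝓝 0) := by simpa using hEk.const_mul 2
    refine squeeze_zero' (Eventually.of_forall fun n => ?_) ?_ h2E
    · exact errorProb_nonneg (prodExt_nonneg hW n) (sum_prodExt hW1 n) (prodExt_nonneg hq n)
        (hM n) (c n)
    · filter_upwards [hev] with n hn using (hgood n hn).2

end Achievability

/-! ### The converse -/

section Converse

variable {U V : Type*} [Fintype U]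

open Classical in
/-- The law of a uniformly chosen codeword. -/
noncomputable def codeLaw {M : ℕ} (c : Fin M → U) (u : U) : ℝ :=
  1 / (M : ℝ) * ∑ m, if c m = u then 1 else 0

lemma sum_codeLaw_mul {M : ℕ} (c : Fin M → U) (f : U → ℝ) :
    ∑ u, codeLaw c u * f u = 1 / (M : ℝ) * ∑ m, f (c m) := by
  classical
  simp only [codeLaw, mul_assoc, sum_mul, ← mul_sum]
  congr 1
  rw [sum_comm]
  simp

lemma codeLaw_mem_stdSimplex {M : ℕ} (hM : 0 < M) (c : Fin M → U) :
    codeLaw c ∈ stdSimplex ℝ U := by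
  refine ⟨fun u => mul_nonneg (by positivity) (sum_nonneg fun _ _ => by split_ifs <;> simp), ?_⟩
  have := sum_codeLaw_mul c fun _ => 1
  have hM' : (M : ℝ) ≠ 0 := by positivity
  simpa [hM'] using this

variable [Fintype V]

/-- For the uniform law on a code, the density is `log M` plus the logarithm of the probability of
correct decoding. -/
lemma meanDensity_codeLaw {W q : U → V → ℝ} (hW : ∀ u v, 0 ≤ W u v)
    (hW1 : ∀ u, ∑ v, W u v = 1) (hq : ∀ u v, 0 ≤ q u v) (hWq : ∀ u v, 0 < W u v → 0 < q u v)
    {M : ℕ} (hM : 0 < M) (c : Fin M → U) :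
    meanDensity W q (codeLaw c) = Real.log M +
      1 / (M : ℝ) * ∑ m, ∑ v, W (c m) v * Real.log (decodeProb q c v m) := by
  have hM' : (M : ℝ) ≠ 0 := by positivity
  simp only [meanDensity, mul_assoc, ← mul_sum, sum_codeLaw_mul]
  have hterm : ∀ m, ∑ v, W (c m) v * Real.log (q (c m) v / (1 / (M : ℝ) * ∑ m', q (c m') v)) =
      Real.log M + ∑ v, W (c m) v * Real.log (decodeProb q c v m) := by
    intro m
    have hlog : Real.log M = ∑ v, W (c m) v * Real.log M := by rw [← sum_mul, hW1, one_mul]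
    rw [hlog, ← sum_add_distrib]
    refine sum_congr rfl fun v _ => ?_
    rcases (hW (c m) v).eq_or_lt with h | h
    · simp [← h]
    have hq0 := hWq _ _ h
    have hS : 0 < ∑ m', q (c m') v := hq0.trans_le
      (single_le_sum (f := fun m => q (c m) v) (fun _ _ => hq _ _) (mem_univ m))
    have hd : decodeProb q c v m ≠ 0 := (div_pos hq0 hS).ne'
    rw [← mul_add, ← Real.log_mul hM' hd, decodeProb]
    congr 2
    field_simp
  simp only [hterm, sum_add_distrib, mul_add]
  congr 1
  simp [hM']

/-- A lower bound on the density of a code. If decoding succeeds with probability at least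
`exp (-L)`, then the rare events where it succeeds with probability below `1 / 2` contribute at
most `2 L` times the error probability. -/
lemma le_meanDensity_codeLaw {W q : U → V → ℝ} (hW : ∀ u v, 0 ≤ W u v)
    (hW1 : ∀ u, ∑ v, W u v = 1) (hq : ∀ u v, 0 ≤ q u v) (hWq : ∀ u v, 0 < W u v → 0 < q u v)
    {M : ℕ} (hM : 0 < M) (c : Fin M → U) {L : ℝ} (hL : 0 ≤ L)
    (hdec : ∀ m v, 0 < W (c m) v → Real.exp (-L) ≤ decodeProb q c v m) :
    Real.log M - Real.log 2 - 2 * L * errorProb W q c ≤ meanDensity W q (codeLaw c) := by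
  have hM' : (M : ℝ) ≠ 0 := by positivity
  have hterm : ∀ m, -Real.log 2 - 2 * L * messageError W q c m ≤
      ∑ v, W (c m) v * Real.log (decodeProb q c v m) := by
    intro m
    have : -Real.log 2 - 2 * L * messageError W q c m =
        ∑ v, W (c m) v * (-Real.log 2 - 2 * L * (1 - decodeProb q c v m)) := by
      simp only [mul_sub, sum_sub_distrib, ← sum_mul, hW1, messageError, mul_sum, mul_left_comm]
      ring_nf
    rw [this]
    refine sum_le_sum fun v _ => ?_
    rcases (hW (c m) v).eq_or_lt with h | h
    · simp [← h]
    refine mul_le_mul_of_nonneg_left ?_ h.le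
    have h1 := hdec m v h
    have h2 := decodeProb_le_one hq c v m
    set d := decodeProb q c v m
    have hlog2 : 0 ≤ Real.log 2 := Real.log_nonneg one_le_two
    rcases le_total (1 / 2) d with hd | hd
    · have h3 := Real.log_le_log (by norm_num) hd
      rw [one_div, Real.log_inv] at h3
      nlinarith
    · have h3 := Real.log_le_log (Real.exp_pos _) h1
      rw [Real.log_exp] at h3
      nlinarith
  rw [meanDensity_codeLaw hW hW1 hq hWq hM c, errorProb_eq_average hW1 hM]
  have h4 := mul_le_mul_of_nonneg_left (sum_le_sum fun m (_ : m ∈ univ) => hterm m)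
    (show 0 ≤ 1 / (M : ℝ) by positivity)
  have h5 : 1 / (M : ℝ) * ∑ m : Fin M, (-Real.log 2 - 2 * L * messageError W q c m) =
      -Real.log 2 - 2 * L * (1 / (M : ℝ) * ∑ m, messageError W q c m) := by
    rw [sum_sub_distrib, ← mul_sum, sum_const, card_univ, Fintype.card_fin, nsmul_eq_mul]
    field_simp
  linarith

end Converse

section MemorylessConverse

variable {X Y : Type*} [Fintype X] [Fintype Y]

/-- With distinct codewords, the probability of correct decoding is at least exponentially
small. -/
lemma exists_exp_le_decodeProb [Nonempty X] {W q : X → Y → ℝ} (hW : ∀ x y, 0 ≤ W x y)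
    (hq : ∀ x y, 0 ≤ q x y) (hWq : ∀ x y, 0 < W x y → 0 < q x y) :
    ∃ L : ℝ, 0 ≤ L ∧ ∀ (n M : ℕ) (c : Fin M → Fin n → X), Function.Injective c →
      ∀ m y, 0 < prodExt n W (c m) y → Real.exp (-(n * L)) ≤ decodeProb (prodExt n q) c y m := by
  -- `qmax` and `1 / qinv` bound all values and all positive values of `q`; the junk inverses of
  -- the zero values of `q` do no harm in `qinv`.
  set qmax := 1 + ∑ x, ∑ y, q x y with hqmax
  set qinv := 1 + ∑ x, ∑ y, (q x y)⁻¹ with hqinv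
  have hsum : ∀ f : X → Y → ℝ, (∀ x y, 0 ≤ f x y) → ∀ x y, f x y ≤ 1 + ∑ x, ∑ y, f x y := by
    intro f hf x y
    have h1 : f x y ≤ ∑ y, f x y :=
      single_le_sum (f := fun y => f x y) (fun _ _ => hf _ _) (mem_univ y)
    have h2 : ∑ y, f x y ≤ ∑ x, ∑ y, f x y :=
      single_le_sum (f := fun x => ∑ y, f x y) (fun _ _ => sum_nonneg fun _ _ => hf _ _)
        (mem_univ x)
    linarith
  have hmax : ∀ x y, q x y ≤ qmax := hsum q hq
  have hinv : ∀ x y, (q x y)⁻¹ ≤ qinv := hsum _ fun x y => inv_nonneg.2 (hq x y)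
  have hmax1 : 1 ≤ qmax := le_add_of_nonneg_right (sum_nonneg fun _ _ => sum_nonneg fun _ _ =>
    hq _ _)
  have hinv1 : 1 ≤ qinv := le_add_of_nonneg_right (sum_nonneg fun _ _ => sum_nonneg fun _ _ =>
    inv_nonneg.2 (hq _ _))
  have hcard : (1 : ℝ) ≤ Fintype.card X := by exact_mod_cast Fintype.card_pos
  set D : ℝ := Fintype.card X * qmax * qinv with hD
  have hD1 : 1 ≤ D := one_le_mul_of_one_le_of_one_le
    (one_le_mul_of_one_le_of_one_le hcard hmax1) hinv1
  refine ⟨Real.log D, Real.log_nonneg hD1, fun n M c hc m y hy => ?_⟩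
  rw [← mul_neg, Real.exp_nat_mul, Real.exp_neg, Real.exp_log (by linarith), decodeProb]
  have hqpos : 0 < prodExt n q (c m) y := prodExt_pos_of_pos hW hWq n _ _ hy
  have hS : 0 < ∑ m', prodExt n q (c m') y := hqpos.trans_le
    (single_le_sum (f := fun m => prodExt n q (c m) y) (fun _ _ => prodExt_nonneg hq _ _ _)
      (mem_univ m))
  have hM : (M : ℝ) ≤ (Fintype.card X : ℝ) ^ n := by
    have := Fintype.card_le_of_injective c hc
    rw [Fintype.card_fin, Fintype.card_fun, Fintype.card_fin] at this
    exact_mod_cast this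
  have hnum : (qinv⁻¹) ^ n ≤ prodExt n q (c m) y := by
    have hconst : qinv⁻¹ ^ n = ∏ _i : Fin n, qinv⁻¹ := by simp
    rw [hconst]
    refine prod_le_prod (fun _ _ => inv_nonneg.2 (by linarith)) fun i _ => ?_
    exact inv_le_of_inv_le₀ (hWq _ _ (pos_of_prodExt_pos hW hy i)) (hinv _ _)
  have hden : ∑ m', prodExt n q (c m') y ≤ (Fintype.card X * qmax) ^ n := by
    calc _ ≤ ∑ _m' : Fin M, qmax ^ n := by
          refine sum_le_sum fun m' _ => ?_
          refine (prod_le_prod (fun _ _ => hq _ _) fun i _ => hmax _ _).trans ?_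
          simp
      _ = M * qmax ^ n := by simp
      _ ≤ _ := by
          rw [mul_pow]
          exact mul_le_mul_of_nonneg_right hM (by positivity)
  rw [le_div_iff₀ hS]
  calc _ ≤ (D⁻¹) ^ n * (Fintype.card X * qmax) ^ n :=
        mul_le_mul_of_nonneg_left hden (by positivity)
    _ = (qinv⁻¹) ^ n := by
        rw [← mul_pow, hD]
        congr 1
        field_simp
    _ ≤ _ := hnum

/-- Below the mismatch capacity, the uniform laws on good codes have a normalized density that
exceeds the rate. -/
theorem eventually_lt_meanDensity [Nonempty X] {W q : X → Y → ℝ} (hW : ∀ x y, 0 ≤ W x y)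
    (hW1 : ∀ x, ∑ y, W x y = 1) (hq : ∀ x y, 0 ≤ q x y) (hWq : ∀ x y, 0 < W x y → 0 < q x y)
    {R : ℝ} (hR : (R : EReal) < mismatchCapacity W q) :
    ∀ᶠ k : ℕ in atTop, ∃ P ∈ stdSimplex ℝ (Fin k → X),
      k * R < meanDensity (prodExt k W) (prodExt k q) P := by
  obtain ⟨R₂, hR₂, hRR₂⟩ := lt_iSup_iff.1 hR |>.imp fun _ h => lt_iSup_iff.1 h
  rw [EReal.coe_lt_coe_iff] at hRR₂
  obtain ⟨R₁, h1, h2⟩ := exists_between hRR₂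
  obtain ⟨M, c, hM, hinj, hlim, herr⟩ := hR₂
  obtain ⟨L, hL, hdec⟩ := exists_exp_le_decodeProb hW hq hWq
  have hrate : ∀ᶠ n : ℕ in atTop, R₁ < Real.log (M n) / n := by
    have := eventually_lt_of_lt_liminf ((EReal.coe_lt_coe_iff.2 h2).trans_le hlim)
    simpa only [EReal.coe_lt_coe_iff] using this
  have hsmall : Tendsto (fun n : ℕ => Real.log 2 / n +
      2 * L * errorProb (prodExt n W) (prodExt n q) (c n)) atTop (𝓝 0) := by
    simpa using (tendsto_const_div_atTop_nhds_zero_nat (Real.log 2)).add (herr.const_mul (2 * L))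
  filter_upwards [hrate, hsmall.eventually_lt_const (sub_pos.2 h1), eventually_ne_atTop 0]
    with n hn hs hn0
  have hn0' : (0 : ℝ) < n := by positivity
  refine ⟨codeLaw (c n), codeLaw_mem_stdSimplex (hM n) (c n), ?_⟩
  have h3 := le_meanDensity_codeLaw (prodExt_nonneg hW n) (sum_prodExt hW1 n)
    (prodExt_nonneg hq n) (prodExt_pos_of_pos hW hWq n) (hM n) (c n)
    (mul_nonneg hn0'.le hL) (hdec n (M n) (c n) (hinj n))
  refine lt_of_lt_of_le ?_ h3
  rw [lt_div_iff₀ hn0'] at hn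
  have h4 := mul_lt_mul_of_pos_right hs hn0'
  rw [add_mul, div_mul_cancel₀ _ hn0'.ne'] at h4
  linarith

end MemorylessConverse

/-! ### The three limits -/

section Capacities

variable {X Y : Type*} [Fintype X] [Fintype Y] {W q : X → Y → ℝ}

lemma gmiDensity_one (W q : X → Y → ℝ) (P : X → ℝ) :
    gmiDensity W q P 1 = meanDensity W q P := by
  simp [gmiDensity, meanDensity]

lemma lmDensity_zero (W q : X → Y → ℝ) (P : X → ℝ) (s : ℝ) :
    lmDensity W q P s 0 = gmiDensity W q P s := by
  simp [gmiDensity, lmDensity]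

lemma le_gmiRate (W q : X → Y → ℝ) (k : ℕ) (P : (Fin k → X) → ℝ) :
    ((1 / (k : ℝ) * meanDensity (prodExt k W) (prodExt k q) P : ℝ) : EReal) ≤
      gmiRate W q k P := by
  rw [← gmiDensity_one]
  exact le_iSup₂_of_le 1 (by simp) le_rfl

lemma gmiRate_le_lmRate (W q : X → Y → ℝ) (k : ℕ) (P : (Fin k → X) → ℝ) :
    gmiRate W q k P ≤ lmRate W q k P :=
  iSup₂_mono fun s _ => le_iSup_of_le 0 (by rw [lmDensity_zero])

lemma meanDensityCapacity_le_gmiCapacity (W q : X → Y → ℝ) (k : ℕ) :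
    meanDensityCapacity W q k ≤ gmiCapacity W q k :=
  iSup₂_mono fun P _ => le_gmiRate W q k P

lemma gmiCapacity_le_lmCapacity (W q : X → Y → ℝ) (k : ℕ) :
    gmiCapacity W q k ≤ lmCapacity W q k :=
  iSup₂_mono fun P _ => gmiRate_le_lmRate W q k P

lemma coe_lt_of_mul_lt {k : ℕ} (hk : k ≠ 0) {R I : ℝ} (h : k * R < I) :
    (R : EReal) < ((1 / (k : ℝ) * I : ℝ) : EReal) := by
  rw [EReal.coe_lt_coe_iff, one_div, inv_mul_eq_div, lt_div_iff₀ (by positivity)]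
  rwa [mul_comm]

/-- The `k`-letter LM rates do not exceed the capacity, since constant-composition random coding
achieves them. -/
theorem lmCapacity_le_mismatchCapacity [Nonempty X] (hW : ∀ x y, 0 ≤ W x y)
    (hW1 : ∀ x, ∑ y, W x y = 1) (hq : ∀ x y, 0 ≤ q x y) (hWq : ∀ x y, 0 < W x y → 0 < q x y)
    {k : ℕ} (hk : k ≠ 0) : lmCapacity W q k ≤ mismatchCapacity W q := by
  refine iSup₂_le fun P hP => iSup₂_le fun s hs => iSup_le fun a => ?_
  refine le_of_forall_lt fun A hA => ?_
  obtain ⟨R, hAR, hR⟩ := EReal.lt_iff_exists_real_btwn.1 hA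
  refine hAR.trans_le (le_iSup₂_of_le R ?_ le_rfl)
  refine (constCompAchieves_of_lt hW hW1 hq hWq hP hs.1.le hs.2 a ?_).isAchievable hW hW1 hq hWq hk
  rw [EReal.coe_lt_coe_iff, one_div, inv_mul_eq_div, lt_div_iff₀ (by positivity)] at hR
  rwa [mul_comm]

end Capacities

end StochDec

theorem theorem4 {X Y : Type*} [Fintype X] [Nonempty X] [Fintype Y]
    (W q : X → Y → ℝ)
    (hW_nonneg : ∀ x y, 0 ≤ W x y) (hW_sum : ∀ x, ∑ y, W x y = 1)
    (hq_nonneg : ∀ x y, 0 ≤ q x y) (hq_pos : ∀ x y, 0 < W x y → 0 < q x y) :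
    Tendsto (fun k => StochDec.gmiCapacity W q k) atTop (𝓝 (StochDec.mismatchCapacity W q)) ∧
    Tendsto (fun k => StochDec.lmCapacity W q k) atTop (𝓝 (StochDec.mismatchCapacity W q)) ∧
    Tendsto (fun k => StochDec.meanDensityCapacity W q k) atTop
      (𝓝 (StochDec.mismatchCapacity W q)) ∧
    (∀ R : ℝ, (R : EReal) < StochDec.mismatchCapacity W q →
      ∀ᶠ k : ℕ in atTop,
        (∃ P ∈ stdSimplex ℝ (Fin k → X),
          (R : EReal) < StochDec.gmiRate W q k P ∧ StochDec.IIDAchieves W q k P R) ∧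
        (∃ P ∈ stdSimplex ℝ (Fin k → X),
          (R : EReal) < StochDec.lmRate W q k P ∧ StochDec.ConstCompAchieves W q k P R)) := by
  have hub : ∀ᶠ k : ℕ in atTop, StochDec.lmCapacity W q k ≤ StochDec.mismatchCapacity W q :=
    (eventually_ne_atTop 0).mono fun k hk =>
      StochDec.lmCapacity_le_mismatchCapacity hW_nonneg hW_sum hq_nonneg hq_pos hk
  have hmean : Tendsto (fun k => StochDec.meanDensityCapacity W q k) atTop
      (𝓝 (StochDec.mismatchCapacity W q)) := by
    refine tendsto_order.2 ⟨fun A hA => ?_, fun A hA => ?_⟩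
    · obtain ⟨R, hAR, hR⟩ := EReal.lt_iff_exists_real_btwn.1 hA
      filter_upwards [eventually_ne_atTop 0, StochDec.eventually_lt_meanDensity hW_nonneg hW_sum
        hq_nonneg hq_pos hR] with k hk ⟨P, hP, hlt⟩
      refine hAR.trans (lt_of_lt_of_le (StochDec.coe_lt_of_mul_lt hk hlt) ?_)
      exact le_iSup₂_of_le P hP le_rfl
    · filter_upwards [hub] with k hk
      exact ((StochDec.meanDensityCapacity_le_gmiCapacity W q k).trans
        ((StochDec.gmiCapacity_le_lmCapacity W q k).trans hk)).trans_lt hA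
  refine ⟨?_, ?_, hmean, fun R hR => ?_⟩
  · refine tendsto_of_tendsto_of_tendsto_of_le_of_le' hmean tendsto_const_nhds
      (Eventually.of_forall fun k => StochDec.meanDensityCapacity_le_gmiCapacity W q k) ?_
    filter_upwards [hub] with k hk using (StochDec.gmiCapacity_le_lmCapacity W q k).trans hk
  · exact tendsto_of_tendsto_of_tendsto_of_le_of_le' hmean tendsto_const_nhds
      (Eventually.of_forall fun k => (StochDec.meanDensityCapacity_le_gmiCapacity W q k).trans
        (StochDec.gmiCapacity_le_lmCapacity W q k)) hub
  · filter_upwards [eventually_ne_atTop 0, StochDec.eventually_lt_meanDensity hW_nonneg hW_sum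
      hq_nonneg hq_pos hR] with k hk ⟨P, hP, hlt⟩
    have hgmi := (StochDec.coe_lt_of_mul_lt hk hlt).trans_le (StochDec.le_gmiRate W q k P)
    refine ⟨⟨P, hP, hgmi, ?_⟩, P, hP, hgmi.trans_le (StochDec.gmiRate_le_lmRate W q k P), ?_⟩
    · refine StochDec.iidAchieves_of_lt hW_nonneg hW_sum hq_nonneg hq_pos hP zero_le_one le_rfl ?_
      rwa [StochDec.gmiDensity_one]
    · refine StochDec.constCompAchieves_of_lt hW_nonneg hW_sum hq_nonneg hq_pos hP zero_le_one
        le_rfl 0 ?_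
      rwa [StochDec.lmDensity_zero, StochDec.gmiDensity_one]
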